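/- Let $n\ge 1$ and $j\ge 1$ be integers. Write $e_{r,c}$ for the elementary $(2n+1)\times(2n+1)$ matrices and $e_1=(1,0,\dots,0)^t$. Put $$C_n=\sum_{i=1}^{2n+1}(-1)^{n+i-1}e_{i,2n+2-i},\qquad \langle X,Y\rangle=X^tC_nY \ \text{ on }\mathbb R^{2n+1},\qquad b=\sum_{i=1}^{2n}e_{i+1,i},$$ $$\beta_i=e_{n+1-i,n+i}+e_{n+2-i,n+1+i}\ (1\le i\le n),\qquad V_n=\bigoplus_{i=1}^n\mathbb R\beta_i .$$ Let $O(n+1,n)=\{g: g^tC_ng=C_n\}$, $o(n+1,n)=\{A: A^tC_n+C_nA=0\}$, and let $\mathcal N_n^+$ be the set of strictly upper triangular matrices in $o(n+1,n)$. For matrix functions, $[\partial_x+b+u,Q]:=Q_x+[b+u,Q]$. *Curves.* $\mathcal M_{n+1,n}$ is the set of smooth $\gamma:\mathbb R\to\mathbb R^{2n+1}$ such that, at every point, $\gamma,\gamma_x,\dots,\gamma_x^{(2n)}$ are linearly independent, $\gamma,\dots,\gamma_x^{(n-1)}$ span a maximal isotropic subspace, and $\langle\gamma_x^{(n)},\gamma_x^{(n)}\rangle=1$.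 The isotropic moving frame and the isotropic curvature along $\gamma\in\mathcal M_{n+1,n}$ are the smooth maps $g:\mathbb R\to O(n+1,n)$ and $u:\mathbb R\to V_n$ such that the first $n+1$ columns of $g$ are $\gamma,\gamma_x,\dots,\gamma_x^{(n)}$ and $g^{-1}g_x=b+u$. *The series.* Let $J_B=b+\tfrac12\lambda(e_{1,2n}+e_{2,2n+1})$ and $J=b+\lambda e_{1,2n+1}$. For smooth $u:\mathbb R\to V_n$ let $P(u,\lambda)$ (B-type) be the formal series $\sum_{i\le 1}P_i\lambda^i$, with smooth coefficients $P_i:\mathbb R\to o(n+1,n)$, that is pointwise in $x$ conjugate to $J_B$ (over formal Laurent series in $\lambda^{-1}$ with real coefficients), satisfies $[\partial_x+J_B+u,P]=0$, and has the same coefficient of $\lambda$ as $J_B$. Let $S(u,\lambda)$ (A-type) be the formal series $\sum_{i\le 1}S_i\lambda^i$ with smooth real trace-free coefficients satisfying $C_nS(u,-\lambda)^tC_n+S(u,\lambda)=0$, that is pointwise conjugate to $J$, satisfies $[\partial_x+J+u,S]=0$, and has the same coefficient of $\lambda$ as $J$. Let $P_{2j-1,0}(u)$ and $S_{2j-1,0}(u)$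 be the coefficients of $\lambda^0$ in $P(u,\lambda)^{2j-1}$ and $S(u,\lambda)^{2j-1}$. Let $\eta_j(u)$ and $\tilde\eta_j(u)$ be the smooth $\mathcal N_n^+$-valued functions for which $Q=P_{2j-1,0}(u)-\eta_j(u)$, respectively $Q=S_{2j-1,0}(u)-\tilde\eta_j(u)$, satisfies $[\partial_x+b+u,Q]\in V_n$. In the A-type case assume $2j-1\not\equiv0\pmod{2n+1}$. *The flows.* The $(2j-1)$-th $\hat B_n^{(1)}$-KdV flow (respectively $\hat A_{2n}^{(2)}$-KdV flow), for smooth $u:\mathbb R^2\to V_n$, is $u_t=[\partial_x+b+u,Q(u)]$ with the first (respectively second) choice of $Q$. The $(2j-1)$-th isotropic curve flow on $\mathcal M_{n+1,n}$ of B-type (respectively A-type), for smooth $\gamma:\mathbb R^2\to\mathbb R^{2n+1}$ with $\gamma(\cdot,t)\in\mathcal M_{n+1,n}$ for all $t$, is $\gamma_t=g\,P_{2j-1,0}(u)e_1$ (respectively $\gamma_t=g\,S_{2j-1,0}(u)e_1$), where $g(\cdot,t)$ and $u(\cdot,t)$ are the isotropic moving frame and curvature along $\gamma(\cdot,t)$.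 **Theorem.** For the B-type and for the A-type: (i) If $\gamma$ is a solution of the $(2j-1)$-th isotropic curve flow, then its isotropic curvature $u$ is a solution of the $(2j-1)$-th KdV flow of the same type. (ii) Let $u$ be a solution of the $(2j-1)$-th KdV flow, let $c_0\in O(n+1,n)$, and let $g$ be the solution (a smooth map from $\mathbb R^2$ to the invertible matrices) of $$g^{-1}g_x=b+u,\qquad g^{-1}g_t=Q(u),\qquad g(0,0)=c_0 .$$ Then $\gamma:=g e_1$ is a solution of the $(2j-1)$-th isotropic curve flow of the same type, and for each $t$, $g(\cdot,t)$ is the isotropic moving frame and $u(\cdot,t)$ the isotropic curvature along $\gamma(\cdot,t)$. -/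

import Mathlib

open scoped ContDiff

noncomputable section

namespace IsotropicFlow

/-- Column vectors of length `2n+1`. -/
abbrev Vec (n : ℕ) := Fin (2 * n + 1) → ℝ

/-- Real square matrices of size `2n+1`. -/
abbrev Mat (n : ℕ) := Matrix (Fin (2 * n + 1)) (Fin (2 * n + 1)) ℝ

/-- The elementary matrix `e_{r,c}`; the indices `r`, `c` are counted from `1` to `2n+1`. -/
def E (n r c : ℕ) : Mat n :=
  Matrix.of fun i k => if i.val + 1 = r ∧ k.val + 1 = c then 1 else 0

/-- The vector `e_1`. -/
def e1 (n : ℕ) : Vec n := Pi.single 0 1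

/-- `C_n = ∑_{i=1}^{2n+1} (-1)^{n+i-1} e_{i,2n+2-i}`. -/
def Cform (n : ℕ) : Mat n :=
  ∑ i ∈ Finset.Icc 1 (2 * n + 1), (-1 : ℝ) ^ (n + i - 1) • E n i (2 * n + 2 - i)

/-- The bilinear form `⟨X, Y⟩ = Xᵗ C_n Y`. -/
def form (n : ℕ) (X Y : Vec n) : ℝ := X ⬝ᵥ (Cform n).mulVec Y

/-- `g` lies in `O(n+1,n)`. -/
def IsOrth (n : ℕ) (g : Mat n) : Prop := g.transpose * Cform n * g = Cform n

/-- `A` lies in the Lie algebra `o(n+1,n)`. -/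
def IsOrthAlg (n : ℕ) (A : Mat n) : Prop := A.transpose * Cform n + Cform n * A = 0

/-- `A` lies in `𝒩_n^+`, the strictly upper triangular matrices in `o(n+1,n)`. -/
def IsNilUpper (n : ℕ) (A : Mat n) : Prop :=
  IsOrthAlg n A ∧ ∀ i k, k ≤ i → A i k = 0

/-- `b = ∑_{i=1}^{2n} e_{i+1,i}`. -/
def b (n : ℕ) : Mat n := ∑ i ∈ Finset.Icc 1 (2 * n), E n (i + 1) i

/-- `β_i = e_{n+1-i,n+i} + e_{n+2-i,n+1+i}`, for `1 ≤ i ≤ n`. -/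
def β (n i : ℕ) : Mat n := E n (n + 1 - i) (n + i) + E n (n + 2 - i) (n + 1 + i)

/-- `V_n`, the span of `β_1, …, β_n`. -/
def V (n : ℕ) : Submodule ℝ (Mat n) := Submodule.span ℝ (β n '' Set.Icc 1 n)

/-- Smoothness of a matrix valued function of one real variable. -/
def Smooth1 {n : ℕ} (M : ℝ → Mat n) : Prop :=
  ∀ i k, ContDiff ℝ ∞ (fun x => M x i k)

/-- Joint smoothness of a matrix valued function of two real variables. -/
def Smooth2 {n : ℕ} (M : ℝ → ℝ → Mat n) : Prop :=
  ∀ i k, ContDiff ℝ ∞ (fun p : ℝ × ℝ => M p.1 p.2 i k)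

/-- The entrywise derivative of a matrix valued function of one real variable. -/
def mderiv {n : ℕ} (M : ℝ → Mat n) (x : ℝ) : Mat n :=
  Matrix.of fun i k => deriv (fun y => M y i k) x

/-- `[∂_x + b + u, Q] = Q_x + [b + u, Q]`. -/
def covD (n : ℕ) (u Q : ℝ → Mat n) (x : ℝ) : Mat n :=
  mderiv Q x + ((b n + u x) * Q x - Q x * (b n + u x))

/-! ### Isotropic curves, moving frames and curvature -/

/-- A subspace on which the bilinear form vanishes identically. -/
def IsIsotropicSubspace (n : ℕ) (W : Submodule ℝ (Vec n)) : Prop :=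
  ∀ X ∈ W, ∀ Y ∈ W, form n X Y = 0

/-- Isotropic curves in `ℝ^{n+1,n}`. -/
structure IsIsotropicCurve (n : ℕ) (γ : ℝ → Vec n) : Prop where
  smooth : ContDiff ℝ ∞ γ
  linInd : ∀ x, LinearIndependent ℝ
    (fun k : Fin (2 * n + 1) => iteratedDeriv k.val γ x)
  maxIso : ∀ x, Maximal (IsIsotropicSubspace n)
    (Submodule.span ℝ (Set.range fun k : Fin n => iteratedDeriv k.val γ x))

/-- The space `ℳ_{n+1,n}` of isotropic curves with isotropic parameter. -/
def curveSpace (n : ℕ) : Set (ℝ → Vec n) :=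
  {γ | IsIsotropicCurve n γ ∧
    ∀ x, form n (iteratedDeriv n γ x) (iteratedDeriv n γ x) = 1}

/-- `g` is the isotropic moving frame and `u` the isotropic curvature along `γ`:
the first `n+1` columns of `g` are `γ, γ_x, …, γ_x^{(n)}` and `g⁻¹ g_x = b + u` with `u`
a smooth map into `V_n`. -/
structure IsFrame (n : ℕ) (γ : ℝ → Vec n) (g u : ℝ → Mat n) : Prop where
  smooth : Smooth1 g
  orth : ∀ x, IsOrth n (g x)
  col : ∀ x, ∀ k : Fin (2 * n + 1), k.val ≤ n →
    (fun i => g x i k) = iteratedDeriv k.val γ x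
  smooth_curv : Smooth1 u
  curv_mem : ∀ x, u x ∈ V n
  eqn : ∀ x, (g x)⁻¹ * mderiv g x = b n + u x

/-! ### The series `P(u,λ)` and `S(u,λ)` -/

/-- The two affine types: `B` stands for `B̂_n^{(1)}` and `A` for `Â_{2n}^{(2)}`. -/
inductive AffineType
  | B
  | A

/-- Formal series `∑_{i ≤ m} ξ_i λ^i` with real matrix coefficients, as Laurent series in
the variable `λ⁻¹`. -/
abbrev Loop (n : ℕ) := LaurentSeries (Mat n)

/-- The coefficient of `λ^i`. -/
def lcoeff {n : ℕ} (i : ℤ) (ξ : Loop n) : Mat n := HahnSeries.coeff ξ (-i)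

/-- The monomial `A λ^i`. -/
def mono {n : ℕ} (i : ℤ) (A : Mat n) : Loop n := HahnSeries.single (-i) A

/-- The coefficient of `λ` in `J_B = b + ½ (e_{1,2n} + e_{2,2n+1}) λ`, respectively in
`J = b + e_{1,2n+1} λ`. -/
def Jtop (n : ℕ) : AffineType → Mat n
  | .B => (1 / 2 : ℝ) • (E n 1 (2 * n) + E n 2 (2 * n + 1))
  | .A => E n 1 (2 * n + 1)

/-- `J_B` for type `B`, and `J` for type `A`. -/
def J (n : ℕ) (ty : AffineType) : Loop n := mono 0 (b n) + mono 1 (Jtop n ty)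

/-- Membership in `B̂_n^{(1)}` (all coefficients in `o(n+1,n)`), respectively in
`Â_{2n}^{(2)}` (trace-free coefficients with `C_n ξ(-λ)ᵗ C_n + ξ(λ) = 0`). -/
def InLoopAlg (n : ℕ) : AffineType → Loop n → Prop
  | .B, ξ => ∀ i : ℤ, IsOrthAlg n (lcoeff i ξ)
  | .A, ξ => ∀ i : ℤ, (lcoeff i ξ).trace = 0 ∧
      ((((-1 : ℤˣ) ^ i : ℤˣ) : ℤ) : ℝ) •
        (Cform n * (lcoeff i ξ).transpose * Cform n) + lcoeff i ξ = 0

/-- `P` is the series `P(u,λ)` (type `B`), respectively `S(u,λ)` (type `A`): it takes values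
in the loop algebra, is conjugate to `J` (`J_B` in type `B`), solves
`[∂_x + J + u, P] = 0`, and has the same leading term in `λ` as `J`. In type `B` the leading
term distinguishes `P` from `-P`, which satisfies all the other conditions. -/
structure IsLaxSeries (n : ℕ) (ty : AffineType) (u : ℝ → Mat n) (P : ℝ → Loop n) :
    Prop where
  smooth : ∀ i : ℤ, Smooth1 (fun x => lcoeff i (P x))
  mem : ∀ x, InLoopAlg n ty (P x)
  conj : ∀ x, IsConj (J n ty) (P x)
  commute : ∀ x, ∀ i : ℤ, mderiv (fun y => lcoeff i (P y)) x +
    lcoeff i ((J n ty + mono 0 (u x)) * P x - P x * (J n ty + mono 0 (u x))) = 0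
  bound : ∀ x, ∀ i : ℤ, 1 < i → lcoeff i (P x) = 0
  top : ∀ x, lcoeff 1 (P x) = Jtop n ty

/-- `M = P_{2j-1,0}(u)` (type `B`), respectively `M = S_{2j-1,0}(u)` (type `A`): the
coefficient of `λ^0` in the `(2j-1)`-st power of the series. -/
def IsZeroCoeff (n : ℕ) (ty : AffineType) (j : ℕ) (u M : ℝ → Mat n) : Prop :=
  ∃ P : ℝ → Loop n, IsLaxSeries n ty u P ∧ ∀ x, M x = lcoeff 0 (P x ^ (2 * j - 1))

/-- `Q = P_{2j-1,0}(u) - η_j(u)` (type `B`), respectively `Q = S_{2j-1,0}(u) - η̃_j(u)`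
(type `A`), where `η` is the smooth `𝒩_n^+`-valued function with
`[∂_x + b + u, Q] ∈ V_n`. -/
def IsFlowMatrix (n : ℕ) (ty : AffineType) (j : ℕ) (u Q : ℝ → Mat n) : Prop :=
  ∃ M η : ℝ → Mat n, IsZeroCoeff n ty j u M ∧
    Smooth1 η ∧ (∀ x, IsNilUpper n (η x)) ∧ (∀ x, Q x = M x - η x) ∧
    ∀ x, covD n u Q x ∈ V n

/-! ### The flows -/

/-- `u(x,t)` is a solution on `ℝ²` of the `(2j-1)`-th `B̂_n^{(1)}`-KdV
(respectively `Â_{2n}^{(2)}`-KdV) flow. -/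
structure IsKdVSolution (n : ℕ) (ty : AffineType) (j : ℕ) (u : ℝ → ℝ → Mat n) :
    Prop where
  smooth : Smooth2 u
  mem : ∀ x t, u x t ∈ V n
  eqn : ∀ t, ∃ Q : ℝ → Mat n, IsFlowMatrix n ty j (fun x => u x t) Q ∧
    ∀ x, mderiv (fun s => u x s) t = covD n (fun y => u y t) Q x

/-- `γ(x,t)` is a solution on `ℝ²` of the `(2j-1)`-th isotropic curve flow of B-type
`γ_t = g P_{2j-1,0}(u) e_1` (respectively of A-type `γ_t = g S_{2j-1,0}(u) e_1`), where
`g(·,t)` and `u(·,t)` are the isotropic moving frame and curvature along `γ(·,t)`. -/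
structure IsCurveFlowSolution (n : ℕ) (ty : AffineType) (j : ℕ) (γ : ℝ → ℝ → Vec n) :
    Prop where
  smooth : ContDiff ℝ ∞ (fun p : ℝ × ℝ => γ p.1 p.2)
  mem : ∀ t, (fun x => γ x t) ∈ curveSpace n
  eqn : ∀ t, ∃ g u M : ℝ → Mat n, IsFrame n (fun x => γ x t) g u ∧
    IsZeroCoeff n ty j u M ∧
    ∀ x, deriv (fun s => γ x s) t = (g x * M x).mulVec (e1 n)

/-- `g(x,t)` is a smooth invertible solution on `ℝ²` of the linear system `g⁻¹ g_x = b + u`,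
`g⁻¹ g_t = P_{2j-1,0}(u) - η_j(u)` (respectively `S_{2j-1,0}(u) - η̃_j(u)`). -/
structure IsLinearSystemSolution (n : ℕ) (ty : AffineType) (j : ℕ)
    (u g : ℝ → ℝ → Mat n) : Prop where
  smooth : Smooth2 g
  unit : ∀ x t, IsUnit (g x t)
  eqn_x : ∀ x t, (g x t)⁻¹ * mderiv (fun y => g y t) x = b n + u x t
  eqn_t : ∀ t, ∃ Q : ℝ → Mat n, IsFlowMatrix n ty j (fun x => u x t) Q ∧
    ∀ x, (g x t)⁻¹ * mderiv (fun s => g x s) t = Q x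

end IsotropicFlow

end

noncomputable section

namespace IsotropicFlow

variable {n : ℕ}

/-! Both directions compare $A=g^{-1}g_t$ with $M$, the $\lambda^0$ coefficient of the odd power of
the Lax series.

Curve flow to KdV. Equality of the mixed partials of $g$ gives $u_t=[\partial_x+b+u,A]$, so it
suffices that $\eta=M-A$ is $\mathcal N_n^+$-valued. It lies in $o(n+1,n)$ because $A$ and $M$ do,
and $\eta e_1=0$ because $gAe_1=\gamma_t=gMe_1$. Moreover $[\partial_x+b+u,\eta]$ vanishes below the
diagonal: for $A$ the bracket is $u_t\in V_n$, and for $M$ the Lax equation turns it into a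
commutator of the $\lambda^{-1}$ coefficient with the top coefficient of $J$
(`IsLaxSeries.covD_pow`, `upper_commutator_Jtop`). Since $b$ shifts columns, these facts propagate
$\eta e_1=0$ column by column to strict upper triangularity (`strictly_upper_of_upper_covD`).

This needs $g$ and $u$ jointly smooth in $(x,t)$, while a frame is only given for each $t$
separately. `IsFrame.step` recovers the remaining columns and the curvature recursively from
$\gamma$ and its $x$-derivatives; this yields joint smoothness and uniqueness of the frame.

Linear system to curve flow. Both coefficient matrices lie in $o(n+1,n)$, so $gC_ng^t$ is constant
and $g$ stays in $O(n+1,n)$. The $x$-equation makes $g$ the frame along $ge_1$, and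
$\gamma_t=gQe_1=gMe_1$ because a strictly upper triangular $\eta$ kills $e_1$. -/

/-- The vector with entry `1` at the position `c`, counted from `0`; it is `0` for `2n < c`. -/
def basisVec (n c : ℕ) : Vec n := fun k => if k.val = c then 1 else 0

theorem e1_eq_basisVec : e1 n = basisVec n 0 := by
  ext k
  rw [e1, basisVec, Pi.single_apply]
  exact if_congr Fin.ext_iff rfl rfl

theorem mulVec_basisVec (A : Mat n) (k : Fin (2 * n + 1)) :
    A.mulVec (basisVec n k.val) = fun i => A i k := by
  ext i
  simp [Matrix.mulVec, dotProduct, basisVec, ← Fin.ext_iff]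

/-! ### Entries of $C_n$ and $b$, and the Lie algebra $o(n+1,n)$. -/

theorem E_apply (r c : ℕ) (i k : Fin (2 * n + 1)) :
    E n r c i k = if i.val + 1 = r ∧ k.val + 1 = c then 1 else 0 := rfl

theorem Cform_apply (i k : Fin (2 * n + 1)) :
    Cform n i k = if k = i.rev then (-1) ^ (n + i.val) else 0 := by
  unfold Cform
  rw [Matrix.sum_apply, Finset.sum_eq_single (i.val + 1)]
  · simp only [Matrix.smul_apply, E_apply, smul_eq_mul, Fin.ext_iff, Fin.val_rev, true_and]
    have h1 := i.isLt
    have h2 := k.isLt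
    by_cases h : k.val = 2 * n + 1 - (i.val + 1)
    · rw [if_pos h, if_pos (show k.val + 1 = 2 * n + 2 - (i.val + 1) by omega), mul_one]
      congr 1
    · rw [if_neg h, if_neg (by omega), mul_zero]
  · intro m _ hm
    simp only [Matrix.smul_apply, E_apply, smul_eq_mul]
    rw [if_neg (by omega), mul_zero]
  · intro h
    exact absurd (Finset.mem_Icc.2 ⟨by omega, by have := i.isLt; omega⟩) h

theorem neg_one_pow_rev (i : Fin (2 * n + 1)) :
    (-1 : ℝ) ^ i.rev.val = (-1) ^ i.val := by
  have h1 := i.isLt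
  rcases Nat.even_or_odd i.val with h | h
  · rw [h.neg_one_pow, Even.neg_one_pow]
    rw [Fin.val_rev]
    obtain ⟨m, hm⟩ := h
    exact ⟨n - m, by omega⟩
  · rw [h.neg_one_pow, Odd.neg_one_pow]
    rw [Fin.val_rev]
    obtain ⟨m, hm⟩ := h
    exact ⟨n - m - 1, by omega⟩

theorem Cform_mul_apply (A : Mat n) (i k : Fin (2 * n + 1)) :
    (Cform n * A) i k = (-1) ^ (n + i.val) * A i.rev k := by
  simp [Matrix.mul_apply, Cform_apply]

theorem mul_Cform_apply (A : Mat n) (i k : Fin (2 * n + 1)) :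
    (A * Cform n) i k = (-1) ^ (n + k.val) * A i k.rev := by
  rw [Matrix.mul_apply, Finset.sum_eq_single k.rev]
  · rw [Cform_apply, Fin.rev_rev, if_pos rfl, pow_add, neg_one_pow_rev, pow_add, mul_comm]
  · intro l _ hl
    rw [Cform_apply, if_neg, mul_zero]
    rintro rfl
    simp at hl
  · simp

theorem Cform_mul_self : Cform n * Cform n = 1 := by
  ext i k
  rw [Cform_mul_apply, Cform_apply, Fin.rev_rev, Matrix.one_apply]
  by_cases h : i = k
  · subst h
    rw [if_pos rfl, if_pos rfl, pow_add, pow_add, neg_one_pow_rev, ← pow_add, ← pow_add,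
      Even.neg_one_pow ⟨n + i.val, rfl⟩]
  · rw [if_neg (Ne.symm h), if_neg h, mul_zero]

/-- Since $C_n^2=1$, membership in $o(n+1,n)$ is skewness for $A\mapsto C_nA^tC_n$, the form shared
with the A-type reality condition. -/
theorem isOrthAlg_iff_conj {A : Mat n} :
    IsOrthAlg n A ↔ Cform n * A.transpose * Cform n + A = 0 := by
  unfold IsOrthAlg
  have key : Cform n * (A.transpose * Cform n + Cform n * A) =
      Cform n * A.transpose * Cform n + A := by
    rw [mul_add, ← mul_assoc, ← mul_assoc, Cform_mul_self, one_mul]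
  constructor
  · intro h
    rw [← key, h, mul_zero]
  · intro h
    rw [← key] at h
    have := congrArg (Cform n * ·) h
    simpa only [← mul_assoc, Cform_mul_self, one_mul, mul_zero] using this

theorem isOrthAlg_iff_entries {A : Mat n} : IsOrthAlg n A ↔
    ∀ i k, (-1) ^ k.val * A k.rev i + (-1) ^ i.val * A i.rev k = 0 := by
  unfold IsOrthAlg
  have key : ∀ i k, (A.transpose * Cform n + Cform n * A) i k =
      (-1) ^ n * ((-1) ^ k.val * A k.rev i + (-1) ^ i.val * A i.rev k) := by
    intro i k
    rw [Matrix.add_apply, mul_Cform_apply, Cform_mul_apply, Matrix.transpose_apply]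
    ring
  rw [← Matrix.ext_iff]
  refine forall₂_congr fun i k => ?_
  rw [key, Matrix.zero_apply, mul_eq_zero]
  simp

theorem IsOrthAlg.add {A B : Mat n} (hA : IsOrthAlg n A) (hB : IsOrthAlg n B) :
    IsOrthAlg n (A + B) := by
  rw [isOrthAlg_iff_entries] at *
  intro i k
  rw [Matrix.add_apply, Matrix.add_apply]
  linear_combination hA i k + hB i k

theorem IsOrthAlg.sub {A B : Mat n} (hA : IsOrthAlg n A) (hB : IsOrthAlg n B) :
    IsOrthAlg n (A - B) := by
  rw [isOrthAlg_iff_entries] at *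
  intro i k
  rw [Matrix.sub_apply, Matrix.sub_apply]
  linear_combination hA i k - hB i k

/-- The entry of an element of `o(n+1,n)` in the lower left corner vanishes. -/
theorem IsOrthAlg.corner {A : Mat n} (hA : IsOrthAlg n A) {i k : Fin (2 * n + 1)}
    (hi : i.val = 2 * n) (hk : k.val = 0) : A i k = 0 := by
  have h := isOrthAlg_iff_entries.1 hA k k
  have : k.rev = i := by
    ext
    rw [Fin.val_rev]
    omega
  rw [this, hk] at h
  linarith

theorem b_apply (i k : Fin (2 * n + 1)) :
    b n i k = if i.val = k.val + 1 then 1 else 0 := by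
  unfold b
  rw [Matrix.sum_apply]
  have h1 := i.isLt
  by_cases h : i.val = k.val + 1
  · rw [if_pos h, Finset.sum_eq_single (k.val + 1)]
    · rw [E_apply, if_pos (by omega)]
    · intro m _ hm
      rw [E_apply, if_neg (by omega)]
    · intro h'
      exact absurd (Finset.mem_Icc.2 ⟨by omega, by omega⟩) h'
  · rw [if_neg h]
    refine Finset.sum_eq_zero fun m _ => ?_
    rw [E_apply, if_neg (by omega)]

theorem isOrthAlg_b : IsOrthAlg n (b n) := by
  rw [isOrthAlg_iff_entries]
  intro i k
  have h1 := i.isLt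
  have h2 := k.isLt
  rw [b_apply, b_apply, Fin.val_rev, Fin.val_rev]
  by_cases h : i.val + k.val + 1 = 2 * n
  · rw [if_pos (by omega), if_pos (by omega), mul_one, mul_one]
    rcases Nat.even_or_odd i.val with hi | hi
    · have hk : Odd k.val := by
        obtain ⟨m, hm⟩ := hi
        exact ⟨n - m - 1, by omega⟩
      rw [hi.neg_one_pow, hk.neg_one_pow]
      norm_num
    · have hk : Even k.val := by
        obtain ⟨m, hm⟩ := hi
        exact ⟨n - m - 1, by omega⟩
      rw [hi.neg_one_pow, hk.neg_one_pow]
      norm_num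
  · rw [if_neg (by omega), if_neg (by omega)]
    simp

/-! ### The space `V_n` -/

/-- The coefficient of `β_i` of an element of `V_n`. -/
def curvCoeff (i : ℕ) (u : Mat n) : ℝ :=
  if h : 1 ≤ i ∧ i ≤ n then u ⟨n - i, by omega⟩ ⟨n + i - 1, by omega⟩ else 0

/-- The two summands are the two antidiagonals that carry the entries of the $\beta_i$. The shape
facts about $V_n$ below are read off from this formula. -/
theorem apply_of_mem_V {u : Mat n} (hu : u ∈ V n) (r k : Fin (2 * n + 1)) :
    u r k = (if r.val + k.val + 1 = 2 * n ∧ n ≤ k.val then curvCoeff (k.val + 1 - n) u else 0) +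
      (if r.val + k.val = 2 * n + 1 ∧ n + 1 ≤ k.val then curvCoeff (k.val - n) u else 0) := by
  have hr := r.isLt
  have hk := k.isLt
  unfold V at hu
  induction hu using Submodule.span_induction with
  | mem w hw =>
    obtain ⟨m, ⟨hm1, hm2⟩, rfl⟩ := hw
    have hc : ∀ i, curvCoeff i (β n m) = if i = m then 1 else 0 := by
      intro i
      unfold curvCoeff
      split_ifs with h1 h2 h2
      · subst h2
        simp only [β, Matrix.add_apply, E_apply]
        rw [if_pos (by omega), if_neg (by omega), add_zero]
      · simp only [β, Matrix.add_apply, E_apply]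
        rw [if_neg (by omega), if_neg (by omega), add_zero]
      · omega
      · rfl
    rw [hc, hc]
    simp only [β, Matrix.add_apply, E_apply, ← ite_and]
    congr 1
    · exact if_congr (by omega) rfl rfl
    · exact if_congr (by omega) rfl rfl
  | zero => simp [curvCoeff]
  | add v w _ _ hv hw =>
    have hc : ∀ i, curvCoeff i (v + w) = curvCoeff i v + curvCoeff i w := by
      intro i
      unfold curvCoeff
      split_ifs
      · rfl
      · simp
    rw [Matrix.add_apply, hv, hw, hc, hc]
    split_ifs <;> ring
  | smul a w _ hw =>
    have hc : ∀ i, curvCoeff i (a • w) = a * curvCoeff i w := by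
      intro i
      unfold curvCoeff
      split_ifs
      · rfl
      · simp
    rw [Matrix.smul_apply, hw, hc, hc, smul_eq_mul]
    split_ifs <;> ring

theorem upper_of_mem_V {u : Mat n} (hu : u ∈ V n) {r k : Fin (2 * n + 1)} (h : k ≤ r) :
    u r k = 0 := by
  have h' : k.val ≤ r.val := h
  rw [apply_of_mem_V hu, if_neg (by omega), if_neg (by omega), add_zero]

theorem col_of_mem_V {u : Mat n} (hu : u ∈ V n) {r k : Fin (2 * n + 1)} (h : k.val < n) :
    u r k = 0 := by
  rw [apply_of_mem_V hu, if_neg (by omega), if_neg (by omega), add_zero]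

theorem isOrthAlg_of_mem_V {u : Mat n} (hu : u ∈ V n) : IsOrthAlg n u := by
  rw [isOrthAlg_iff_entries]
  intro i k
  have h1 := i.isLt
  have h2 := k.isLt
  rw [apply_of_mem_V hu, apply_of_mem_V hu, Fin.val_rev, Fin.val_rev]
  by_cases hik : k.val = i.val + 1
  · rw [hik]
    by_cases hn : n ≤ i.val
    · rw [if_pos (by omega), if_neg (by omega), if_neg (by omega), if_pos (by omega)]
      ring
    · rw [if_neg (by omega), if_neg (by omega), if_neg (by omega), if_neg (by omega)]
      ring
  · by_cases hki : i.val = k.val + 1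
    · rw [hki]
      by_cases hn : n ≤ k.val
      · rw [if_neg (by omega), if_pos (by omega), if_pos (by omega), if_neg (by omega)]
        ring
      · rw [if_neg (by omega), if_neg (by omega), if_neg (by omega), if_neg (by omega)]
        ring
    · rw [if_neg (by omega), if_neg (by omega), if_neg (by omega), if_neg (by omega)]
      ring

theorem b_mulVec_apply (v : Vec n) (i : Fin (2 * n + 1)) {k : Fin (2 * n + 1)}
    (h : i.val = k.val + 1) : (b n).mulVec v i = v k := by
  rw [Matrix.mulVec, dotProduct, Finset.sum_eq_single k]
  · rw [b_apply, if_pos h, one_mul]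
  · intro l _ hl
    rw [b_apply, if_neg, zero_mul]
    intro h'
    exact hl (Fin.ext (by omega))
  · simp

theorem b_mulVec_basisVec {c : ℕ} (hc : c < 2 * n + 1) :
    (b n).mulVec (basisVec n c) = basisVec n (c + 1) := by
  rw [mulVec_basisVec (b n) ⟨c, hc⟩]
  ext i
  rw [b_apply, basisVec]

theorem mulVec_basisVec_of_mem_V {u : Mat n} (hu : u ∈ V n) {c : ℕ} (hc : c < n) :
    u.mulVec (basisVec n c) = 0 := by
  rw [mulVec_basisVec u ⟨c, by omega⟩]
  ext i
  exact col_of_mem_V hu hc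

/-- Each column to the right of the first $n$ meets at most two of the $\beta_i$. For `m = 0` the
second term is absent because `curvCoeff 0` is zero by default. -/
theorem mulVec_basisVec_add_of_mem_V {u : Mat n} (hu : u ∈ V n) {m : ℕ} (hm : m < n) :
    u.mulVec (basisVec n (n + m)) = curvCoeff (m + 1) u • basisVec n (n - 1 - m) +
      curvCoeff m u • basisVec n (n + 1 - m) := by
  rw [mulVec_basisVec u ⟨n + m, by omega⟩]
  ext i
  rw [apply_of_mem_V hu]
  simp only [basisVec, Pi.add_apply, Pi.smul_apply, smul_eq_mul, mul_ite, mul_one, mul_zero]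
  congr 1
  · refine if_congr (by omega) ?_ rfl
    congr 1
    omega
  · rcases Nat.eq_zero_or_pos m with rfl | hm'
    · rw [if_neg (by omega)]
      simp [curvCoeff]
    · refine if_congr (by omega) ?_ rfl
      congr 1
      omega

/-! ### The bilinear form -/

theorem form_apply (X Y : Vec n) :
    form n X Y = ∑ i, X i * ((-1) ^ (n + i.val) * Y i.rev) := by
  unfold form
  rw [dotProduct]
  refine Finset.sum_congr rfl fun i _ => ?_
  congr 1
  simp [Matrix.mulVec, dotProduct, Cform_apply]

theorem form_add_left (X Y Z : Vec n) : form n (X + Y) Z = form n X Z + form n Y Z := by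
  simp [form, add_dotProduct]

theorem form_add_right (X Y Z : Vec n) : form n X (Y + Z) = form n X Y + form n X Z := by
  simp [form, Matrix.mulVec_add, dotProduct_add]

theorem form_smul_left (a : ℝ) (X Y : Vec n) : form n (a • X) Y = a * form n X Y := by
  simp [form]

theorem form_smul_right (a : ℝ) (X Y : Vec n) : form n X (a • Y) = a * form n X Y := by
  simp [form, Matrix.mulVec_smul]

theorem form_zero_right (X : Vec n) : form n X 0 = 0 := by
  simp [form]

theorem form_zero_left (X : Vec n) : form n 0 X = 0 := by
  simp [form]

theorem form_basisVec_left (c : Fin (2 * n + 1)) (Y : Vec n) :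
    form n (basisVec n c.val) Y = (-1) ^ (n + c.val) * Y c.rev := by
  rw [form_apply, Finset.sum_eq_single c]
  · simp [basisVec]
  · intro i _ hi
    rw [basisVec, if_neg (fun h => hi (Fin.ext h)), zero_mul]
  · simp

theorem form_basisVec {r c : ℕ} (hr : r < 2 * n + 1) :
    form n (basisVec n r) (basisVec n c) = if r + c = 2 * n then (-1) ^ (n + r) else 0 := by
  rw [form_basisVec_left ⟨r, hr⟩, basisVec, Fin.val_rev, mul_ite, mul_one, mul_zero]
  exact if_congr (by simp; omega) rfl rfl

theorem form_mulVec {g : Mat n} (hg : IsOrth n g) (X Y : Vec n) :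
    form n (g.mulVec X) (g.mulVec Y) = form n X Y := by
  unfold form
  rw [← Matrix.vecMul_transpose, ← Matrix.dotProduct_mulVec, Matrix.mulVec_mulVec,
    Matrix.mulVec_mulVec, show g.transpose * Cform n * g = Cform n from hg]

theorem IsOrth.mul_eq_one {g : Mat n} (hg : IsOrth n g) :
    Cform n * g.transpose * Cform n * g = 1 := by
  unfold IsOrth at hg
  rw [mul_assoc, mul_assoc, ← mul_assoc g.transpose, hg, Cform_mul_self]

theorem IsOrth.isUnit {g : Mat n} (hg : IsOrth n g) : IsUnit g :=
  IsUnit.of_mul_eq_one_right _ hg.mul_eq_one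

theorem IsOrth.inv_eq {g : Mat n} (hg : IsOrth n g) :
    g⁻¹ = Cform n * g.transpose * Cform n :=
  Matrix.inv_eq_left_inv hg.mul_eq_one

/-- Needed because the quantity conserved by $g_x=gA$ is $gC_ng^t$, not $g^tC_ng$. -/
theorem isOrth_of_transpose {g : Mat n} (hg : g * Cform n * g.transpose = Cform n) :
    IsOrth n g := by
  have h1 : g * (Cform n * g.transpose * Cform n) = 1 := by
    rw [← mul_assoc, ← mul_assoc, hg, Cform_mul_self]
  have h2 := mul_eq_one_comm.1 h1
  unfold IsOrth
  calc g.transpose * Cform n * g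
      = Cform n * Cform n * (g.transpose * Cform n * g) := by rw [Cform_mul_self, one_mul]
    _ = Cform n * (Cform n * g.transpose * Cform n * g) := by simp only [mul_assoc]
    _ = Cform n := by rw [h2, mul_one]

theorem IsOrth.mul_transpose {g : Mat n} (hg : IsOrth n g) :
    g * Cform n * g.transpose = Cform n := by
  have h1 := mul_eq_one_comm.1 hg.mul_eq_one
  calc g * Cform n * g.transpose
      = g * Cform n * g.transpose * (Cform n * Cform n) := by rw [Cform_mul_self, mul_one]
    _ = g * (Cform n * g.transpose * Cform n) * Cform n := by simp only [mul_assoc]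
    _ = Cform n := by rw [h1, one_mul]

/-! ### Partial derivatives of functions of two real variables -/

section Partial

variable {F : Type*} [NormedAddCommGroup F] [NormedSpace ℝ F] {f : ℝ → ℝ → F}

theorem hasDerivAt_fst (hf : ContDiff ℝ ∞ fun p : ℝ × ℝ => f p.1 p.2) (x t : ℝ) :
    HasDerivAt (fun y => f y t) (fderiv ℝ (fun p : ℝ × ℝ => f p.1 p.2) (x, t) (1, 0)) x := by
  have h1 : HasFDerivAt (fun p : ℝ × ℝ => f p.1 p.2) _ (x, t) :=
    (hf.differentiable (by simp) (x, t)).hasFDerivAt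
  have h2 : HasDerivAt (fun y : ℝ => (y, t)) (1, 0) x :=
    (hasDerivAt_id x).prodMk (hasDerivAt_const x t)
  exact h1.comp_hasDerivAt x h2

theorem hasDerivAt_snd (hf : ContDiff ℝ ∞ fun p : ℝ × ℝ => f p.1 p.2) (x t : ℝ) :
    HasDerivAt (fun s => f x s) (fderiv ℝ (fun p : ℝ × ℝ => f p.1 p.2) (x, t) (0, 1)) t := by
  have h1 : HasFDerivAt (fun p : ℝ × ℝ => f p.1 p.2) _ (x, t) :=
    (hf.differentiable (by simp) (x, t)).hasFDerivAt
  have h2 : HasDerivAt (fun s : ℝ => (x, s)) (0, 1) t :=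
    (hasDerivAt_const t x).prodMk (hasDerivAt_id t)
  exact h1.comp_hasDerivAt t h2

theorem contDiff_fderiv_apply (hf : ContDiff ℝ ∞ fun p : ℝ × ℝ => f p.1 p.2) (v : ℝ × ℝ) :
    ContDiff ℝ ∞ fun p => fderiv ℝ (fun p : ℝ × ℝ => f p.1 p.2) p v :=
  (hf.fderiv_right (m := ∞) (by simp)).clm_apply contDiff_const

theorem contDiff_deriv_fst (hf : ContDiff ℝ ∞ fun p : ℝ × ℝ => f p.1 p.2) :
    ContDiff ℝ ∞ fun p : ℝ × ℝ => deriv (fun y => f y p.2) p.1 := by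
  simp_rw [fun p : ℝ × ℝ => (hasDerivAt_fst hf p.1 p.2).deriv]
  exact contDiff_fderiv_apply hf (1, 0)

theorem contDiff_deriv_snd (hf : ContDiff ℝ ∞ fun p : ℝ × ℝ => f p.1 p.2) :
    ContDiff ℝ ∞ fun p : ℝ × ℝ => deriv (fun s => f p.1 s) p.2 := by
  simp_rw [fun p : ℝ × ℝ => (hasDerivAt_snd hf p.1 p.2).deriv]
  exact contDiff_fderiv_apply hf (0, 1)

/-- Symmetry of the second Fréchet derivative, evaluated on the two coordinate directions. -/
theorem deriv_deriv_comm (hf : ContDiff ℝ ∞ fun p : ℝ × ℝ => f p.1 p.2) (x t : ℝ) :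
    deriv (fun s => deriv (fun y => f y s) x) t = deriv (fun y => deriv (fun s => f y s) t) x := by
  simp_rw [fun x t => (hasDerivAt_fst hf x t).deriv, fun x t => (hasDerivAt_snd hf x t).deriv]
  have hd : Differentiable ℝ (fderiv ℝ fun p : ℝ × ℝ => f p.1 p.2) :=
    (hf.fderiv_right (m := ∞) (by simp)).differentiable (by simp)
  have h1 := (hasDerivAt_snd
    (f := fun x t => fderiv ℝ (fun p : ℝ × ℝ => f p.1 p.2) (x, t) (1, 0))
    (contDiff_fderiv_apply hf (1, 0)) x t).deriv
  have h2 := (hasDerivAt_fst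
    (f := fun x t => fderiv ℝ (fun p : ℝ × ℝ => f p.1 p.2) (x, t) (0, 1))
    (contDiff_fderiv_apply hf (0, 1)) x t).deriv
  rw [h1, h2, fderiv_clm_apply (hd _) (differentiableAt_const _),
    fderiv_clm_apply (hd _) (differentiableAt_const _)]
  simpa using (hf.contDiffAt.isSymmSndFDerivAt
    (by rw [minSmoothness_of_isRCLikeNormedField]; exact ENat.LEInfty.out)).eq (0, 1) (1, 0)

theorem contDiff_iteratedDeriv_fst (hf : ContDiff ℝ ∞ fun p : ℝ × ℝ => f p.1 p.2) (k : ℕ) :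
    ContDiff ℝ ∞ fun p : ℝ × ℝ => iteratedDeriv k (fun y => f y p.2) p.1 := by
  induction k with
  | zero => simpa using hf
  | succ k ih =>
    simp_rw [iteratedDeriv_succ]
    exact contDiff_deriv_fst (f := fun x t => iteratedDeriv k (fun y => f y t) x) ih

end Partial

/-! ### Derivatives of matrix valued functions -/

theorem Smooth1.hasDerivAt {M : ℝ → Mat n} (hM : Smooth1 M) (x : ℝ) (i k : Fin (2 * n + 1)) :
    HasDerivAt (fun y => M y i k) (mderiv M x i k) x :=
  ((hM i k).differentiable (by simp) x).hasDerivAt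

theorem Smooth1.add {M N : ℝ → Mat n} (hM : Smooth1 M) (hN : Smooth1 N) :
    Smooth1 fun x => M x + N x := fun i k => (hM i k).add (hN i k)

theorem Smooth1.sub {M N : ℝ → Mat n} (hM : Smooth1 M) (hN : Smooth1 N) :
    Smooth1 fun x => M x - N x := fun i k => (hM i k).sub (hN i k)

theorem Smooth1.mul {M N : ℝ → Mat n} (hM : Smooth1 M) (hN : Smooth1 N) :
    Smooth1 fun x => M x * N x := fun i k => by
  simp only [Matrix.mul_apply]
  exact ContDiff.sum fun l _ => (hM i l).mul (hN l k)

theorem Smooth1.transpose {M : ℝ → Mat n} (hM : Smooth1 M) :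
    Smooth1 fun x => (M x).transpose := fun i k => hM k i

theorem smooth1_const (A : Mat n) : Smooth1 fun _ => A := fun _ _ => contDiff_const

theorem Smooth1.sum {ι : Type*} {s : Finset ι} {M : ι → ℝ → Mat n}
    (hM : ∀ a ∈ s, Smooth1 (M a)) : Smooth1 fun x => ∑ a ∈ s, M a x := fun i k => by
  simp only [Matrix.sum_apply]
  exact ContDiff.sum fun a ha => hM a ha i k

theorem Smooth2.left {M : ℝ → ℝ → Mat n} (hM : Smooth2 M) (t : ℝ) : Smooth1 fun x => M x t :=
  fun i k => (hM i k).comp (contDiff_id.prodMk contDiff_const)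

theorem Smooth2.right {M : ℝ → ℝ → Mat n} (hM : Smooth2 M) (x : ℝ) : Smooth1 fun t => M x t :=
  fun i k => (hM i k).comp (contDiff_const.prodMk contDiff_id)

theorem Smooth2.mderiv_right {M : ℝ → ℝ → Mat n} (hM : Smooth2 M) :
    Smooth2 fun x t => mderiv (fun s => M x s) t := fun i k => contDiff_deriv_snd (f := fun x t => M x t i k) (hM i k)

theorem Smooth2.mderiv_comm {M : ℝ → ℝ → Mat n} (hM : Smooth2 M) (x t : ℝ) :
    mderiv (fun s => mderiv (fun y => M y s) x) t =
      mderiv (fun y => mderiv (fun s => M y s) t) x := by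
  ext i k
  exact deriv_deriv_comm (f := fun x t => M x t i k) (hM i k) x t

theorem mderiv_const (A : Mat n) (x : ℝ) : mderiv (fun _ => A) x = 0 := by
  ext i k
  exact deriv_const x _

theorem mderiv_add {M N : ℝ → Mat n} (hM : Smooth1 M) (hN : Smooth1 N) (x : ℝ) :
    mderiv (fun y => M y + N y) x = mderiv M x + mderiv N x := by
  ext i k
  exact ((hM.hasDerivAt x i k).add (hN.hasDerivAt x i k)).deriv

theorem mderiv_sub {M N : ℝ → Mat n} (hM : Smooth1 M) (hN : Smooth1 N) (x : ℝ) :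
    mderiv (fun y => M y - N y) x = mderiv M x - mderiv N x := by
  ext i k
  exact ((hM.hasDerivAt x i k).sub (hN.hasDerivAt x i k)).deriv

theorem mderiv_mul {M N : ℝ → Mat n} (hM : Smooth1 M) (hN : Smooth1 N) (x : ℝ) :
    mderiv (fun y => M y * N y) x = mderiv M x * N x + M x * mderiv N x := by
  ext i k
  rw [Matrix.add_apply, Matrix.mul_apply, Matrix.mul_apply, ← Finset.sum_add_distrib]
  have h : HasDerivAt (fun y => ∑ l, M y i l * N y l k)
      (∑ l, (mderiv M x i l * N x l k + M x i l * mderiv N x l k)) x :=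
    HasDerivAt.fun_sum fun l _ => (hM.hasDerivAt x i l).mul (hN.hasDerivAt x l k)
  simpa only [mderiv, Matrix.of_apply, Matrix.mul_apply] using h.deriv

theorem mderiv_sum {ι : Type*} {s : Finset ι} {M : ι → ℝ → Mat n}
    (hM : ∀ a ∈ s, Smooth1 (M a)) (x : ℝ) :
    mderiv (fun y => ∑ a ∈ s, M a y) x = ∑ a ∈ s, mderiv (M a) x := by
  ext i k
  rw [Matrix.sum_apply]
  have h : HasDerivAt (fun y => ∑ a ∈ s, M a y i k) (∑ a ∈ s, mderiv (M a) x i k) x :=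
    HasDerivAt.fun_sum fun a ha => (hM a ha).hasDerivAt x i k
  simpa only [mderiv, Matrix.of_apply, Matrix.sum_apply] using h.deriv

theorem mderiv_transpose (M : ℝ → Mat n) (x : ℝ) :
    mderiv (fun y => (M y).transpose) x = (mderiv M x).transpose := rfl

theorem Smooth1.hasDerivAt_mulVec {M : ℝ → Mat n} (hM : Smooth1 M) {v : ℝ → Vec n} {v' : Vec n}
    {x : ℝ} (hv : HasDerivAt v v' x) :
    HasDerivAt (fun y => (M y).mulVec (v y)) ((mderiv M x).mulVec (v x) + (M x).mulVec v') x := by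
  rw [hasDerivAt_pi] at hv ⊢
  intro i
  simp only [Matrix.mulVec, dotProduct, Pi.add_apply, ← Finset.sum_add_distrib]
  exact HasDerivAt.fun_sum fun l _ => (hM.hasDerivAt x i l).mul (hv l)

/-- A matrix valued function with vanishing derivative is constant. -/
theorem eq_of_mderiv_eq_zero {M : ℝ → Mat n} (hM : Smooth1 M) (h : ∀ x, mderiv M x = 0)
    (x y : ℝ) : M x = M y := by
  ext i k
  refine is_const_of_deriv_eq_zero ((hM i k).differentiable (by simp)) (fun z => ?_) x y
  exact congrFun (congrFun (h z) i) k

/-! ### Products of formal series -/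

/-- Degree bounds make the Cauchy product a sum over an interval that depends only on the bounds.
For families in $x$ the index set is therefore fixed and the sum can be differentiated termwise. -/
theorem lcoeff_mul {p q : ℤ} {ξ ζ : Loop n} (hξ : ∀ i, p < i → lcoeff i ξ = 0)
    (hζ : ∀ i, q < i → lcoeff i ζ = 0) (a : ℤ) :
    lcoeff a (ξ * ζ) = ∑ i ∈ Finset.Icc (a - q) p, lcoeff i ξ * lcoeff (a - i) ζ := by
  unfold lcoeff at *
  rw [HahnSeries.coeff_mul]
  -- Exponents of the Hahn series are powers of $\lambda^{-1}$, hence the sign.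
  refine Finset.sum_of_injOn (fun ij => -ij.1) ?_ ?_ ?_ ?_
  · rintro ⟨i, k⟩ h ⟨i', k'⟩ h' he
    simp only [Finset.mem_coe, Finset.mem_antidiagonal] at h h' he
    have := h.2.2
    have := h'.2.2
    ext <;> simp <;> omega
  · rintro ⟨i, k⟩ h
    simp only [Finset.mem_coe, Finset.mem_antidiagonal, HahnSeries.mem_support] at h
    obtain ⟨h1, h2, h3⟩ := h
    simp only [Finset.coe_Icc, Set.mem_Icc]
    constructor
    · by_contra hlt
      apply h2
      rw [← neg_neg k]
      exact hζ _ (by omega)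
    · by_contra hlt
      apply h1
      rw [← neg_neg i]
      exact hξ _ (by omega)
  · intro i _ hi
    by_contra hne
    apply hi
    refine ⟨(-i, -(a - i)), ?_, by simp⟩
    simp only [Finset.mem_coe, Finset.mem_antidiagonal, HahnSeries.mem_support]
    exact ⟨left_ne_zero_of_mul hne, right_ne_zero_of_mul hne, by omega⟩
  · rintro ⟨i, k⟩ h
    simp only [Finset.mem_antidiagonal] at h
    obtain ⟨-, -, h3⟩ := h
    simp only [neg_neg]
    congr 2
    omega

theorem lcoeff_add (a : ℤ) (ξ ζ : Loop n) : lcoeff a (ξ + ζ) = lcoeff a ξ + lcoeff a ζ := rfl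

theorem lcoeff_sub (a : ℤ) (ξ ζ : Loop n) : lcoeff a (ξ - ζ) = lcoeff a ξ - lcoeff a ζ := rfl

theorem lcoeff_mono (a m : ℤ) (A : Mat n) : lcoeff a (mono m A) = if a = m then A else 0 := by
  unfold lcoeff mono
  by_cases h : a = m
  · rw [if_pos h, h, HahnSeries.coeff_single_same]
  · rw [if_neg h, HahnSeries.coeff_single_of_ne (by omega)]

theorem lcoeff_mono_mul (a m : ℤ) (A : Mat n) (ξ : Loop n) :
    lcoeff a (mono m A * ξ) = A * lcoeff (a - m) ξ := by
  unfold lcoeff mono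
  rw [HahnSeries.coeff_single_mul]
  congr 2
  ring

theorem lcoeff_mul_mono (a m : ℤ) (A : Mat n) (ξ : Loop n) :
    lcoeff a (ξ * mono m A) = lcoeff (a - m) ξ * A := by
  unfold lcoeff mono
  rw [HahnSeries.coeff_mul_single]
  congr 2
  ring

/-! ### Derivatives of loop valued functions -/

/-- `ξ` is a smooth family of series, of degree at most `p`, whose derivative is `ξ'`. -/
structure HasLoopDeriv (n : ℕ) (p : ℤ) (ξ ξ' : ℝ → Loop n) : Prop where
  bound : ∀ x i, p < i → lcoeff i (ξ x) = 0
  smooth : ∀ i, Smooth1 fun x => lcoeff i (ξ x)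
  deriv : ∀ x i, mderiv (fun y => lcoeff i (ξ y)) x = lcoeff i (ξ' x)

theorem HasLoopDeriv.bound_deriv {p : ℤ} {ξ ξ' : ℝ → Loop n} (h : HasLoopDeriv n p ξ ξ')
    (x : ℝ) (i : ℤ) (hi : p < i) : lcoeff i (ξ' x) = 0 := by
  rw [← h.deriv]
  simp_rw [fun y => h.bound y i hi]
  exact mderiv_const 0 x

theorem HasLoopDeriv.mul {p q : ℤ} {ξ ξ' ζ ζ' : ℝ → Loop n} (hξ : HasLoopDeriv n p ξ ξ')
    (hζ : HasLoopDeriv n q ζ ζ') :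
    HasLoopDeriv n (p + q) (fun x => ξ x * ζ x) (fun x => ξ' x * ζ x + ξ x * ζ' x) where
  bound x i hi := by
    rw [lcoeff_mul (hξ.bound x) (hζ.bound x), Finset.Icc_eq_empty (by omega), Finset.sum_empty]
  smooth i := by
    simp_rw [fun x => lcoeff_mul (hξ.bound x) (hζ.bound x) i]
    exact Smooth1.sum fun l _ => (hξ.smooth l).mul (hζ.smooth (i - l))
  deriv x i := by
    simp_rw [fun x => lcoeff_mul (hξ.bound x) (hζ.bound x) i]
    rw [mderiv_sum (fun l _ => (hξ.smooth l).mul (hζ.smooth (i - l))), lcoeff_add,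
      lcoeff_mul (hξ.bound_deriv x) (hζ.bound x), lcoeff_mul (hξ.bound x) (hζ.bound_deriv x),
      ← Finset.sum_add_distrib]
    refine Finset.sum_congr rfl fun l _ => ?_
    rw [mderiv_mul (hξ.smooth l) (hζ.smooth (i - l)), hξ.deriv, hζ.deriv]

/-- Powers of a solution of the Lax equation `ξ' = [ξ, L]` are solutions. -/
theorem HasLoopDeriv.pow {p : ℤ} {ξ L : ℝ → Loop n}
    (hξ : HasLoopDeriv n p ξ fun x => ξ x * L x - L x * ξ x) (k : ℕ) :
    HasLoopDeriv n (k * p) (fun x => ξ x ^ k) fun x => ξ x ^ k * L x - L x * ξ x ^ k := by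
  induction k with
  | zero =>
    have h1 : (1 : Loop n) = mono 0 1 := rfl
    refine ⟨fun x i hi => ?_, fun i => ?_, fun x i => ?_⟩
    · rw [pow_zero, h1, lcoeff_mono, if_neg]
      simp at hi
      omega
    · simp only [pow_zero]
      exact smooth1_const _
    · simp only [pow_zero, one_mul, mul_one, sub_self]
      exact mderiv_const _ x
  | succ k ih =>
    have h := ih.mul hξ
    simp only [← pow_succ] at h
    convert h using 2
    · push_cast
      ring
    · rw [pow_succ]
      simp only [sub_mul, mul_sub, mul_assoc]
      abel

/-! ### The anti-involutions -/

/-- The sign of the anti-involution that defines the loop algebra: it is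
`ξ(λ) ↦ C_n ξ(±λ)ᵗ C_n`. -/
def loopSign : AffineType → ℤˣ
  | .B => 1
  | .A => -1

/-- The relation `ζ(λ) = C_n ξ(ελ)ᵗ C_n`. -/
def IsLoopAdjoint (n : ℕ) (ε : ℤˣ) (ξ ζ : Loop n) : Prop :=
  ∀ i : ℤ, lcoeff i ζ =
    (((ε ^ i : ℤˣ) : ℤ) : ℝ) • (Cform n * (lcoeff i ξ).transpose * Cform n)

theorem InLoopAlg.isLoopAdjoint {ty : AffineType} {ξ : Loop n} (h : InLoopAlg n ty ξ) :
    IsLoopAdjoint n (loopSign ty) ξ (-ξ) := by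
  intro i
  have hneg : lcoeff i (-ξ) = -lcoeff i ξ := rfl
  rw [hneg]
  cases ty with
  | B =>
    have h1 := isOrthAlg_iff_conj.1 (h i)
    simp only [loopSign, one_zpow, Units.val_one, Int.cast_one, one_smul]
    exact (eq_neg_of_add_eq_zero_left h1).symm
  | A => exact (eq_neg_of_add_eq_zero_left (h i).2).symm

/-- Transposition reverses products, the inner $C_nC_n$ cancels, and
$\varepsilon^a=\varepsilon^i\varepsilon^{a-i}$ distributes the sign; so the map is an
anti-homomorphism. -/
theorem IsLoopAdjoint.mul {ε : ℤˣ} {p q : ℤ} {ξ ξ' ζ ζ' : Loop n} (hξ : IsLoopAdjoint n ε ξ ξ')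
    (hζ : IsLoopAdjoint n ε ζ ζ') (hp : ∀ i, p < i → lcoeff i ξ = 0)
    (hq : ∀ i, q < i → lcoeff i ζ = 0) :
    IsLoopAdjoint n ε (ξ * ζ) (ζ' * ξ') := by
  have hp' : ∀ i, p < i → lcoeff i ξ' = 0 := fun i hi => by
    rw [hξ i, hp i hi]
    simp
  have hq' : ∀ i, q < i → lcoeff i ζ' = 0 := fun i hi => by
    rw [hζ i, hq i hi]
    simp
  intro a
  rw [lcoeff_mul hp hq, lcoeff_mul hq' hp', Matrix.transpose_sum, Finset.mul_sum, Finset.sum_mul,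
    Finset.smul_sum]
  refine Finset.sum_nbij' (fun i => a - i) (fun i => a - i) ?_ ?_ ?_ ?_ ?_
  · intro i hi
    rw [Finset.mem_Icc] at hi ⊢
    omega
  · intro i hi
    rw [Finset.mem_Icc] at hi ⊢
    omega
  · intro i _
    ring
  · intro i _
    ring
  · intro i _
    have e1 : a - (a - i) = i := by ring
    have e2 : ε ^ a = ε ^ i * ε ^ (a - i) := by
      rw [← zpow_add]
      congr 1
      ring
    have e3 : Cform n * (lcoeff i ζ).transpose * Cform n *
        (Cform n * (lcoeff (a - i) ξ).transpose * Cform n) =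
        Cform n * (lcoeff i ζ).transpose * (Cform n * Cform n) *
          (lcoeff (a - i) ξ).transpose * Cform n := by simp only [mul_assoc]
    rw [hζ, hξ, e1, e2, Matrix.transpose_mul, Units.val_mul, Int.cast_mul, Matrix.smul_mul,
      Matrix.mul_smul, smul_smul, e3, Cform_mul_self, mul_one, ← mul_assoc (Cform n)]

theorem IsLoopAdjoint.pow {ε : ℤˣ} {p : ℤ} {ξ ξ' : Loop n} (hξ : IsLoopAdjoint n ε ξ ξ')
    (hp : ∀ i, p < i → lcoeff i ξ = 0) (k : ℕ) :
    IsLoopAdjoint n ε (ξ ^ k) (ξ' ^ k) ∧ ∀ i, k * p < i → lcoeff i (ξ ^ k) = 0 := by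
  induction k with
  | zero =>
    have h1 : (1 : Loop n) = mono 0 1 := rfl
    rw [pow_zero, pow_zero, h1]
    constructor
    · intro i
      rw [lcoeff_mono]
      split_ifs with h
      · simp [h, Cform_mul_self]
      · simp
    · intro i hi
      rw [lcoeff_mono, if_neg]
      simp at hi
      omega
  | succ k ih =>
    constructor
    · rw [pow_succ, pow_succ']
      exact ih.1.mul hξ ih.2 hp
    · intro i hi
      rw [pow_succ, lcoeff_mul ih.2 hp, Finset.Icc_eq_empty, Finset.sum_empty]
      push_cast at hi
      intro hle
      linarith

theorem laurentSeries_neg_pow {R : Type*} [Ring R] {k : ℕ} (hk : Odd k) (ξ : LaurentSeries R) :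
    (-ξ) ^ k = -ξ ^ k := hk.neg_pow ξ

/-! ### Coefficients of odd powers of the Lax series -/

section LaxSeries

variable {ty : AffineType} {u : ℝ → Mat n} {P : ℝ → Loop n}

theorem IsLaxSeries.hasLoopDeriv (h : IsLaxSeries n ty u P) :
    HasLoopDeriv n 1 P
      fun x => P x * (J n ty + mono 0 (u x)) - (J n ty + mono 0 (u x)) * P x where
  bound x i hi := h.bound x i hi
  smooth := h.smooth
  deriv x i := by
    rw [eq_neg_of_add_eq_zero_left (h.commute x i), lcoeff_sub, lcoeff_sub, neg_sub]

theorem lcoeff_J_add_mul (w : Mat n) (i : ℤ) (ξ : Loop n) :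
    lcoeff i ((J n ty + mono 0 w) * ξ) =
      (b n + w) * lcoeff i ξ + Jtop n ty * lcoeff (i - 1) ξ := by
  rw [J, add_mul, add_mul, lcoeff_add, lcoeff_add, lcoeff_mono_mul, lcoeff_mono_mul,
    lcoeff_mono_mul, sub_zero, add_mul]
  abel

theorem lcoeff_mul_J_add (w : Mat n) (i : ℤ) (ξ : Loop n) :
    lcoeff i (ξ * (J n ty + mono 0 w)) =
      lcoeff i ξ * (b n + w) + lcoeff (i - 1) ξ * Jtop n ty := by
  rw [J, mul_add, mul_add, lcoeff_add, lcoeff_add, lcoeff_mul_mono, lcoeff_mul_mono,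
    lcoeff_mul_mono, sub_zero, mul_add]
  abel

theorem IsLaxSeries.smooth_pow (h : IsLaxSeries n ty u P) (k : ℕ) (i : ℤ) :
    Smooth1 fun x => lcoeff i (P x ^ k) :=
  (h.hasLoopDeriv.pow k).smooth i

/-- This is the $\lambda^0$ coefficient of $[\partial_x+J+u,P^k]=0$: the only term outside $b+u$ is
the top coefficient of $J$ meeting the $\lambda^{-1}$ coefficient of $P^k$. -/
theorem IsLaxSeries.covD_pow (h : IsLaxSeries n ty u P) (k : ℕ) (x : ℝ) :
    covD n u (fun y => lcoeff 0 (P y ^ k)) x =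
      lcoeff (-1) (P x ^ k) * Jtop n ty - Jtop n ty * lcoeff (-1) (P x ^ k) := by
  unfold covD
  rw [(h.hasLoopDeriv.pow k).deriv, lcoeff_sub, lcoeff_J_add_mul, lcoeff_mul_J_add]
  simp only [zero_sub]
  abel

/-- Odd powers of the Lax series are skew for the anti-involution. -/
theorem IsLaxSeries.skew_pow (h : IsLaxSeries n ty u P) {k : ℕ} (hk : Odd k) (x : ℝ) (i : ℤ) :
    (((loopSign ty ^ i : ℤˣ) : ℤ) : ℝ) •
      (Cform n * (lcoeff i (P x ^ k)).transpose * Cform n) + lcoeff i (P x ^ k) = 0 := by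
  have h1 := ((h.mem x).isLoopAdjoint.pow (h.bound x) k).1 i
  have h2 : (-P x) ^ k = -P x ^ k := laurentSeries_neg_pow hk (P x)
  rw [← h1, h2]
  exact neg_add_cancel (lcoeff i (P x ^ k))

theorem IsLaxSeries.isOrthAlg_pow (h : IsLaxSeries n ty u P) {k : ℕ} (hk : Odd k) (x : ℝ) :
    IsOrthAlg n (lcoeff 0 (P x ^ k)) := by
  have h1 := h.skew_pow hk x 0
  rw [zpow_zero, Units.val_one, Int.cast_one, one_smul] at h1
  exact isOrthAlg_iff_conj.2 h1

/-- In type A the two products live in the last column and the first row. In type B the only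
possible entries below the diagonal are multiples of the lower left corner of $X$, which vanishes
for $X\in o(n+1,n)$. -/
theorem upper_commutator_Jtop {X : Mat n} (hX : ty = .B → IsOrthAlg n X)
    {i k : Fin (2 * n + 1)} (hik : k < i) : (X * Jtop n ty - Jtop n ty * X) i k = 0 := by
  have hik' : k.val < i.val := hik
  have hi := i.isLt
  have h1 : ∀ l, X i l * Jtop n ty l k = 0 := by
    intro l
    cases ty with
    | A =>
      rw [Jtop, E_apply, if_neg (by omega), mul_zero]
    | B =>
      simp only [Jtop, Matrix.smul_apply, Matrix.add_apply, E_apply]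
      rw [if_neg (show ¬ (l.val + 1 = 2 ∧ k.val + 1 = 2 * n + 1) by omega)]
      by_cases hl : l.val + 1 = 1 ∧ k.val + 1 = 2 * n
      · rw [(hX rfl).corner (by omega) (by omega), zero_mul]
      · rw [if_neg hl]
        simp
  have h2 : ∀ l, Jtop n ty i l * X l k = 0 := by
    intro l
    cases ty with
    | A =>
      rw [Jtop, E_apply, if_neg (by omega), zero_mul]
    | B =>
      simp only [Jtop, Matrix.smul_apply, Matrix.add_apply, E_apply]
      rw [if_neg (show ¬ (i.val + 1 = 1 ∧ l.val + 1 = 2 * n) by omega)]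
      by_cases hl : i.val + 1 = 2 ∧ l.val + 1 = 2 * n + 1
      · rw [(hX rfl).corner (by omega) (by omega), mul_zero]
      · rw [if_neg hl]
        simp
  rw [Matrix.sub_apply, Matrix.mul_apply, Matrix.mul_apply, Finset.sum_eq_zero fun l _ => h1 l,
    Finset.sum_eq_zero fun l _ => h2 l, sub_zero]

end LaxSeries

section ZeroCoeff

variable {ty : AffineType} {j : ℕ} {u M : ℝ → Mat n}

theorem odd_two_mul_sub_one (hj : 1 ≤ j) : Odd (2 * j - 1) := ⟨j - 1, by omega⟩

theorem IsZeroCoeff.smooth (h : IsZeroCoeff n ty j u M) : Smooth1 M := by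
  obtain ⟨P, hP, hM⟩ := h
  rw [show M = fun x => lcoeff 0 (P x ^ (2 * j - 1)) from funext hM]
  exact hP.smooth_pow _ 0

theorem IsZeroCoeff.isOrthAlg (hj : 1 ≤ j) (h : IsZeroCoeff n ty j u M) (x : ℝ) :
    IsOrthAlg n (M x) := by
  obtain ⟨P, hP, hM⟩ := h
  rw [hM]
  exact hP.isOrthAlg_pow (odd_two_mul_sub_one hj) x

theorem IsZeroCoeff.upper_covD (hj : 1 ≤ j) (h : IsZeroCoeff n ty j u M) (x : ℝ)
    {i k : Fin (2 * n + 1)} (hik : k < i) : covD n u M x i k = 0 := by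
  obtain ⟨P, hP, hM⟩ := h
  rw [show M = fun x => lcoeff 0 (P x ^ (2 * j - 1)) from funext hM, hP.covD_pow]
  refine upper_commutator_Jtop (fun hB => ?_) hik
  have h1 := hP.skew_pow (odd_two_mul_sub_one hj) x (-1)
  subst hB
  simp only [loopSign, one_zpow, Units.val_one, Int.cast_one, one_smul] at h1
  exact isOrthAlg_iff_conj.2 h1

end ZeroCoeff

/-! ### Moving frames -/

/-- A solution `D` of `D e_1 = 0` for which `[∂_x + b + u, D]` is upper triangular is strictly
upper triangular. -/
theorem strictly_upper_of_upper_covD {u D : ℝ → Mat n} (hu : ∀ x, u x ∈ V n)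
    (h0 : ∀ x i, D x i 0 = 0) (hD : ∀ x i k, k < i → covD n u D x i k = 0) (x : ℝ)
    {i k : Fin (2 * n + 1)} (hik : k ≤ i) : D x i k = 0 := by
  -- Induction on columns: the entry of $[\partial_x+b+u,D]$ just left of $(i,k)$ reduces to
  -- $-D_{ik}$ once the earlier columns are known to vanish on and below the diagonal.
  have key : ∀ m : ℕ, ∀ k : Fin (2 * n + 1), k.val ≤ m → ∀ x i, k ≤ i → D x i k = 0 := by
    intro m
    induction m with
    | zero =>
      intro k hk x i _
      have : k = 0 := Fin.ext (by simpa using hk)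
      rw [this, h0]
    | succ m ih =>
      intro k hk x i hik
      rcases Nat.lt_or_ge k.val (m + 1) with hlt | hge
      · exact ih k (by omega) x i hik
      have hi := i.isLt
      have hik' : k.val ≤ i.val := hik
      obtain ⟨c, hc⟩ : ∃ c : Fin (2 * n + 1), c.val = m := ⟨⟨m, by omega⟩, rfl⟩
      obtain ⟨r, hr⟩ : ∃ r : Fin (2 * n + 1), r.val + 1 = i.val := ⟨⟨i.val - 1, by omega⟩, by
        simp only
        omega⟩
      have hW := hD x i c (by rw [Fin.lt_def]; omega)
      have h1 : mderiv D x i c = 0 := by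
        have : (fun y => D y i c) = fun _ => 0 :=
          funext fun y => ih c (by omega) y i (by rw [Fin.le_def]; omega)
        rw [mderiv, Matrix.of_apply, this]
        exact deriv_const x 0
      have h2 : ((b n + u x) * D x) i c = 0 := by
        rw [Matrix.mul_apply]
        refine Finset.sum_eq_zero fun l _ => ?_
        rcases Nat.lt_or_ge l.val c.val with hl | hl
        · rw [Matrix.add_apply, b_apply, if_neg (by omega),
            upper_of_mem_V (hu x) (by rw [Fin.le_def]; omega), add_zero, zero_mul]
        · rw [ih c (by omega) x l hl, mul_zero]
      have h3 : (D x * (b n + u x)) i c = D x i k := by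
        rw [Matrix.mul_apply, Finset.sum_eq_single k]
        · rw [Matrix.add_apply, b_apply, if_pos (by omega),
            upper_of_mem_V (hu x) (by rw [Fin.le_def]; omega), add_zero, mul_one]
        · intro l _ hl
          have hl' : l.val ≠ k.val := fun h => hl (Fin.ext h)
          rcases Nat.lt_or_ge l.val c.val with hlc | hlc
          · rw [ih l (by omega) x i (by rw [Fin.le_def]; omega), zero_mul]
          · rw [Matrix.add_apply, b_apply, if_neg (by omega),
              upper_of_mem_V (hu x) hlc, add_zero, mul_zero]
        · simp
      rw [covD, Matrix.add_apply, Matrix.sub_apply, h1, h2, h3] at hW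
      linarith
  exact key k.val k le_rfl x i hik

theorem mderiv_eq_of_inv_mul {g g' A : Mat n} (hg : IsUnit g) (h : g⁻¹ * g' = A) : g' = g * A := by
  rw [← h, ← mul_assoc, Matrix.mul_nonsing_inv g ((Matrix.isUnit_iff_isUnit_det g).1 hg), one_mul]

section Frame

variable {γ : ℝ → Vec n} {g u : ℝ → Mat n}

theorem IsFrame.mderiv_eq (h : IsFrame n γ g u) (x : ℝ) : mderiv g x = g x * (b n + u x) :=
  mderiv_eq_of_inv_mul (h.orth x).isUnit (h.eqn x)

theorem IsFrame.mulVec_eq_iteratedDeriv (h : IsFrame n γ g u) (x : ℝ) {c : ℕ} (hc : c ≤ n) :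
    (g x).mulVec (basisVec n c) = iteratedDeriv c γ x := by
  rw [mulVec_basisVec (g x) ⟨c, by omega⟩]
  exact h.col x ⟨c, by omega⟩ hc

/-- The recursion for the columns of the frame and the curvature: with `v` the derivative of
the column `n + m` corrected by the curvature that is already known, the next curvature is
`± ½ ⟨v, v⟩`, and the next column is `v` corrected by it. -/
theorem IsFrame.step (h : IsFrame n γ g u) (x : ℝ) {m : ℕ} (hm : m < n) {v : Vec n}
    (hv : v = (mderiv g x).mulVec (basisVec n (n + m)) -
      curvCoeff m (u x) • (g x).mulVec (basisVec n (n + 1 - m))) :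
    curvCoeff (m + 1) (u x) = (-1) ^ (m + 1) / 2 * form n v v ∧
    (g x).mulVec (basisVec n (n + (m + 1))) =
      v - curvCoeff (m + 1) (u x) • (g x).mulVec (basisVec n (n - 1 - m)) := by
  -- The two basis vectors here are isotropic and pair to $(-1)^{m+1}$, so $\langle v,v\rangle$ is
  -- $2(-1)^{m+1}$ times the new curvature.
  have h1 : v = (g x).mulVec (basisVec n (n + (m + 1)) +
      curvCoeff (m + 1) (u x) • basisVec n (n - 1 - m)) := by
    rw [hv, h.mderiv_eq, ← Matrix.mulVec_mulVec, Matrix.add_mulVec,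
      b_mulVec_basisVec (by omega), mulVec_basisVec_add_of_mem_V (h.curv_mem x) hm,
      Matrix.mulVec_add, Matrix.mulVec_add, Matrix.mulVec_add, Matrix.mulVec_smul,
      Matrix.mulVec_smul, ← add_assoc n m 1]
    abel
  constructor
  · rw [h1, form_mulVec (h.orth x), form_add_left, form_add_right, form_add_right,
      form_smul_left, form_smul_left, form_smul_right, form_smul_right,
      form_basisVec (by omega), form_basisVec (by omega), form_basisVec (by omega),
      form_basisVec (by omega), if_neg (by omega), if_pos (by omega), if_pos (by omega),
      if_neg (by omega)]
    have e1 : (-1 : ℝ) ^ (n + (n + (m + 1))) = (-1) ^ (m + 1) := by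
      rw [← add_assoc, pow_add, Even.neg_one_pow ⟨n, rfl⟩, one_mul]
    have e2 : (-1 : ℝ) ^ (n + (n - 1 - m)) = (-1) ^ (m + 1) := by
      have h2 : (-1 : ℝ) ^ (n + (n - 1 - m)) * (-1) ^ (m + 1) = 1 := by
        rw [← pow_add, Even.neg_one_pow ⟨n, by omega⟩]
      have h3 : (-1 : ℝ) ^ (m + 1) * (-1) ^ (m + 1) = 1 := by
        rw [← pow_add, Even.neg_one_pow ⟨m + 1, rfl⟩]
      exact mul_right_cancel₀ (pow_ne_zero _ (by norm_num)) (h2.trans h3.symm)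
    have h3 : (-1 : ℝ) ^ (m + 1) * (-1) ^ (m + 1) = 1 := by
      rw [← pow_add, Even.neg_one_pow ⟨m + 1, rfl⟩]
    rw [e1, e2]
    linear_combination -(curvCoeff (m + 1) (u x)) * h3
  · rw [h1, Matrix.mulVec_add, Matrix.mulVec_smul]
    abel

end Frame

theorem curvCoeff_zero (w : Mat n) : curvCoeff 0 w = 0 := dif_neg (by omega)

theorem contDiff_form {X Y : ℝ × ℝ → Vec n} (hX : ContDiff ℝ ∞ X) (hY : ContDiff ℝ ∞ Y) :
    ContDiff ℝ ∞ fun p => form n (X p) (Y p) := by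
  simp only [form_apply]
  exact ContDiff.sum fun i _ =>
    (contDiff_pi.1 hX i).mul (contDiff_const.mul (contDiff_pi.1 hY i.rev))

/-! ### Joint smoothness in $(x,t)$ and uniqueness of frame and curvature. -/

section FrameFamily

variable {γ : ℝ → ℝ → Vec n} {g u : ℝ → ℝ → Mat n}

/-- The first $n+1$ columns are $x$-derivatives of $\gamma$; `IsFrame.step` then expresses one more
curvature and one more column smoothly through earlier data. -/
theorem contDiff_frame_columns (hγ : ContDiff ℝ ∞ fun p : ℝ × ℝ => γ p.1 p.2)
    (hF : ∀ t, IsFrame n (fun x => γ x t) (fun x => g x t) (fun x => u x t)) (m : ℕ)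
    (hm : m ≤ n) :
    (∀ c ≤ n + m, ContDiff ℝ ∞ fun p : ℝ × ℝ => (g p.1 p.2).mulVec (basisVec n c)) ∧
      ∀ i ≤ m, ContDiff ℝ ∞ fun p : ℝ × ℝ => curvCoeff i (u p.1 p.2) := by
  induction m with
  | zero =>
    constructor
    · intro c hc
      simp_rw [fun p : ℝ × ℝ => (hF p.2).mulVec_eq_iteratedDeriv p.1 hc]
      exact contDiff_iteratedDeriv_fst hγ c
    · intro i hi
      obtain rfl : i = 0 := by omega
      simp only [curvCoeff_zero]
      exact contDiff_const
  | succ m ih =>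
    obtain ⟨ih1, ih2⟩ := ih (by omega)
    have hd : ContDiff ℝ ∞ fun p : ℝ × ℝ =>
        (mderiv (fun y => g y p.2) p.1).mulVec (basisVec n (n + m)) := by
      have h1 := contDiff_deriv_fst (f := fun x t => (g x t).mulVec (basisVec n (n + m)))
        (ih1 (n + m) le_rfl)
      have h2 : ∀ p : ℝ × ℝ, deriv (fun y => (g y p.2).mulVec (basisVec n (n + m))) p.1 =
          (mderiv (fun y => g y p.2) p.1).mulVec (basisVec n (n + m)) := fun p => by
        rw [((hF p.2).smooth.hasDerivAt_mulVec (hasDerivAt_const p.1 _)).deriv,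
          Matrix.mulVec_zero, add_zero]
      simpa only [h2] using h1
    have hp : ContDiff ℝ ∞ fun p : ℝ × ℝ =>
        curvCoeff m (u p.1 p.2) • (g p.1 p.2).mulVec (basisVec n (n + 1 - m)) := by
      -- For `m = 0` the column `n + 1` is not yet known to be smooth, but its coefficient is zero.
      rcases Nat.eq_zero_or_pos m with h | h
      · simp only [h, curvCoeff_zero, zero_smul]
        exact contDiff_const
      · exact (ih2 m le_rfl).smul (ih1 (n + 1 - m) (by omega))
    have hv := hd.sub hp
    have ha : ContDiff ℝ ∞ fun p : ℝ × ℝ => curvCoeff (m + 1) (u p.1 p.2) := by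
      simp_rw [fun p : ℝ × ℝ => ((hF p.2).step p.1 (show m < n by omega) rfl).1]
      exact contDiff_const.mul (contDiff_form hv hv)
    constructor
    · intro c hc
      rcases Nat.lt_or_ge c (n + (m + 1)) with h | h
      · exact ih1 c (by omega)
      · obtain rfl : c = n + (m + 1) := by omega
        simp_rw [fun p : ℝ × ℝ => ((hF p.2).step p.1 (show m < n by omega) rfl).2]
        exact hv.sub (ha.smul (ih1 (n - 1 - m) (by omega)))
    · intro i hi
      rcases Nat.lt_or_ge i (m + 1) with h | h
      · exact ih2 i (by omega)
      · obtain rfl : i = m + 1 := by omega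
        exact ha

theorem smooth2_frame (hγ : ContDiff ℝ ∞ fun p : ℝ × ℝ => γ p.1 p.2)
    (hF : ∀ t, IsFrame n (fun x => γ x t) (fun x => g x t) (fun x => u x t)) : Smooth2 g := by
  intro i k
  have h := (contDiff_frame_columns hγ hF n le_rfl).1 k.val (by have := k.isLt; omega)
  simp only [mulVec_basisVec] at h
  exact contDiff_pi.1 h i

theorem smooth2_curvature (hγ : ContDiff ℝ ∞ fun p : ℝ × ℝ => γ p.1 p.2)
    (hF : ∀ t, IsFrame n (fun x => γ x t) (fun x => g x t) (fun x => u x t)) : Smooth2 u := by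
  intro r k
  have h := (contDiff_frame_columns hγ hF n le_rfl).2
  have hr := r.isLt
  have hk := k.isLt
  simp_rw [fun p : ℝ × ℝ => apply_of_mem_V ((hF p.2).curv_mem p.1) r k]
  refine ContDiff.add ?_ ?_
  · split_ifs
    · exact h _ (by omega)
    · exact contDiff_const
  · split_ifs
    · exact h _ (by omega)
    · exact contDiff_const

end FrameFamily

/-- The isotropic moving frame and curvature along a curve are unique: gluing two choices at `t = 0` gives a smooth,
hence continuous, family. -/
theorem IsFrame.unique {γ : ℝ → Vec n} {g u g' u' : ℝ → Mat n} (h : IsFrame n γ g u)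
    (h' : IsFrame n γ g' u') : g = g' ∧ u = u' := by
  classical
  have hγ : ContDiff ℝ ∞ γ := by
    have h0 : γ = fun x => (g x).mulVec (basisVec n 0) := by
      funext x
      rw [h.mulVec_eq_iteratedDeriv x (Nat.zero_le n), iteratedDeriv_zero]
    rw [h0, show (fun x => (g x).mulVec (basisVec n 0)) = fun x i => g x i 0 from
      funext fun x => mulVec_basisVec (g x) 0]
    exact contDiff_pi.2 fun i => h.smooth i 0
  have hγ2 : ContDiff ℝ ∞ fun p : ℝ × ℝ => (fun x _ => γ x : ℝ → ℝ → Vec n) p.1 p.2 :=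
    hγ.comp contDiff_fst
  have hF : ∀ t : ℝ, IsFrame n γ (fun x => if t ≤ 0 then g x else g' x)
      (fun x => if t ≤ 0 then u x else u' x) := by
    intro t
    by_cases ht : t ≤ 0
    · simpa only [if_pos ht] using h
    · simpa only [if_neg ht] using h'
  have key : ∀ M M' : ℝ → Mat n, Smooth2 (fun x t => if t ≤ 0 then M x else M' x) → M = M' := by
    intro M M' hM
    funext x
    ext i k
    have hc : Continuous fun t : ℝ => (if t ≤ 0 then M x else M' x) i k :=
      (hM.right x i k).continuous
    have h1 : Filter.Tendsto (fun t : ℝ => (if t ≤ 0 then M x else M' x) i k)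
        (nhdsWithin 0 (Set.Ioi 0)) (nhds (M x i k)) := by
      have := (hc.tendsto 0).mono_left (nhdsWithin_le_nhds (s := Set.Ioi 0))
      rwa [if_pos le_rfl] at this
    have h2 : Filter.Tendsto (fun t : ℝ => (if t ≤ 0 then M x else M' x) i k)
        (nhdsWithin 0 (Set.Ioi 0)) (nhds (M' x i k)) := by
      refine tendsto_const_nhds.congr' ?_
      filter_upwards [self_mem_nhdsWithin] with t ht
      rw [if_neg (not_le.2 ht)]
    exact tendsto_nhds_unique h1 h2
  exact ⟨key g g' (smooth2_frame hγ2 hF), key u u' (smooth2_curvature hγ2 hF)⟩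

/-! ### Derivatives of curves in $V_n$ and in $O(n+1,n)$. -/

theorem mderiv_mem_V {u : ℝ → Mat n} (hs : Smooth1 u) (hu : ∀ x, u x ∈ V n) (x : ℝ) :
    mderiv u x ∈ V n := by
  have hc : IsClosed (V n : Set (Mat n)) := Submodule.closed_of_finiteDimensional _
  have h1 : Filter.Tendsto (fun y => (y - x)⁻¹ • (u y - u x)) (nhdsWithin x {x}ᶜ)
      (nhds (mderiv u x)) :=
    tendsto_pi_nhds.2 fun i => tendsto_pi_nhds.2 fun k =>
      hasDerivAt_iff_tendsto_slope.1 (hs.hasDerivAt x i k)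
  refine hc.mem_of_tendsto h1 (Filter.Eventually.of_forall fun y => ?_)
  exact (V n).smul_mem _ ((V n).sub_mem (hu y) (hu x))

theorem isOrthAlg_inv_mul_mderiv {g : ℝ → Mat n} (hs : Smooth1 g) (hg : ∀ x, IsOrth n (g x))
    (x : ℝ) : IsOrthAlg n ((g x)⁻¹ * mderiv g x) := by
  have h1 : mderiv g x = g x * ((g x)⁻¹ * mderiv g x) :=
    mderiv_eq_of_inv_mul (hg x).isUnit rfl
  set A := (g x)⁻¹ * mderiv g x
  have h2 : mderiv (fun y => (g y).transpose * Cform n * g y) x = 0 := by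
    rw [show (fun y => (g y).transpose * Cform n * g y) = fun _ => Cform n from funext hg,
      mderiv_const]
  rw [mderiv_mul (hs.transpose.mul (smooth1_const _)) hs,
    mderiv_mul hs.transpose (smooth1_const _), mderiv_const, mul_zero, add_zero,
    mderiv_transpose, h1, Matrix.transpose_mul] at h2
  have h3 : (g x).transpose * Cform n * g x = Cform n := hg x
  unfold IsOrthAlg
  calc A.transpose * Cform n + Cform n * A
      = A.transpose * ((g x).transpose * Cform n * g x) +
        (g x).transpose * Cform n * g x * A := by rw [h3]
    _ = 0 := by rw [← h2]; simp only [mul_assoc]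

/-- The derivative is $g(AC_n+C_nA^t)g^t$, and the bracket is the condition $A\in o(n+1,n)$
multiplied by $C_n$ on both sides. -/
theorem mderiv_conj {g : ℝ → Mat n} {A : Mat n} {x : ℝ} (hs : Smooth1 g)
    (h : mderiv g x = g x * A) (hA : IsOrthAlg n A) :
    mderiv (fun y => g y * Cform n * (g y).transpose) x = 0 := by
  have h1 : A * Cform n + Cform n * A.transpose = 0 := by
    have h2 : Cform n * (A.transpose * Cform n + Cform n * A) * Cform n = 0 := by
      rw [show A.transpose * Cform n + Cform n * A = 0 from hA, mul_zero, zero_mul]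
    calc A * Cform n + Cform n * A.transpose
        = Cform n * A.transpose * (Cform n * Cform n) + (Cform n * Cform n) * A * Cform n := by
          rw [Cform_mul_self, mul_one, one_mul, add_comm (A * Cform n)]
      _ = 0 := by rw [← h2]; noncomm_ring
  rw [mderiv_mul (hs.mul (smooth1_const _)) hs.transpose, mderiv_mul hs (smooth1_const _),
    mderiv_const, mul_zero, add_zero, mderiv_transpose, h, Matrix.transpose_mul]
  calc g x * A * Cform n * (g x).transpose + g x * Cform n * (A.transpose * (g x).transpose)
      = g x * (A * Cform n + Cform n * A.transpose) * (g x).transpose := by noncomm_ring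
    _ = 0 := by rw [h1, mul_zero, zero_mul]

/-- On $O(n+1,n)$ the inverse is $C_ng^tC_n$, so its entries are signed entries of $g$. -/
theorem Smooth2.inv_mul {g h : ℝ → ℝ → Mat n} (hg : Smooth2 g) (hh : Smooth2 h)
    (ho : ∀ x t, IsOrth n (g x t)) : Smooth2 fun x t => (g x t)⁻¹ * h x t := by
  intro i k
  have h1 : ∀ x t i l, (g x t)⁻¹ i l =
      (-1) ^ (n + l.val) * ((-1) ^ (n + i.val) * g x t l.rev i.rev) := fun x t i l => by
    rw [(ho x t).inv_eq, mul_Cform_apply, Cform_mul_apply, Matrix.transpose_apply]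
  simp only [Matrix.mul_apply, h1]
  exact ContDiff.sum fun l _ => (contDiff_const.mul (contDiff_const.mul (hg _ _))).mul (hh l k)

/-! ### From the curve flow to the KdV flow -/

theorem covD_sub {u M N : ℝ → Mat n} (hM : Smooth1 M) (hN : Smooth1 N) (x : ℝ) :
    covD n u (fun y => M y - N y) x = covD n u M x - covD n u N x := by
  unfold covD
  rw [mderiv_sub hM hN]
  noncomm_ring

theorem isKdVSolution_of_isCurveFlowSolution {ty : AffineType} {j : ℕ} (hj : 1 ≤ j)
    {γ : ℝ → ℝ → Vec n} (hγ : IsCurveFlowSolution n ty j γ) {g u : ℝ → ℝ → Mat n}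
    (hF : ∀ t, IsFrame n (fun x => γ x t) (fun x => g x t) (fun x => u x t)) :
    IsKdVSolution n ty j u := by
  have hg := smooth2_frame hγ.smooth hF
  have hu := smooth2_curvature hγ.smooth hF
  have ho : ∀ x t, IsOrth n (g x t) := fun x t => (hF t).orth x
  refine ⟨hu, fun x t => (hF t).curv_mem x, fun t => ?_⟩
  set A : ℝ → ℝ → Mat n := fun x t => (g x t)⁻¹ * mderiv (fun s => g x s) t with hAdef
  have hA2 : Smooth2 A := hg.inv_mul hg.mderiv_right ho
  have hgt : ∀ x t, mderiv (fun s => g x s) t = g x t * A x t := fun x t =>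
    mderiv_eq_of_inv_mul (ho x t).isUnit rfl
  have hgx : ∀ x t, mderiv (fun y => g y t) x = g x t * (b n + u x t) := fun x t =>
    (hF t).mderiv_eq x
  -- Zero curvature: expand $g_{xt}=g_{tx}$ and cancel $g$.
  have zero_curv : ∀ x, mderiv (fun s => u x s) t =
      covD n (fun y => u y t) (fun y => A y t) x := by
    intro x
    have hcomm := hg.mderiv_comm x t
    simp_rw [hgx, hgt] at hcomm
    rw [mderiv_mul (hg.right x) ((smooth1_const _).add (hu.right x)),
      mderiv_mul (hg.left t) (hA2.left t), mderiv_add (smooth1_const _) (hu.right x),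
      mderiv_const, zero_add, hgx, hgt] at hcomm
    have h1 : g x t * mderiv (fun s => u x s) t =
        g x t * covD n (fun y => u y t) (fun y => A y t) x := by
      unfold covD
      rw [mul_add, mul_sub]
      simp only [mul_assoc] at hcomm ⊢
      rw [← sub_eq_zero] at hcomm ⊢
      rw [← hcomm]
      abel
    exact (ho x t).isUnit.mul_left_cancel h1
  obtain ⟨g₁, u₁, M, hF₁, hM, hflow⟩ := hγ.eqn t
  -- The flow equation supplies its own frame at time $t$; uniqueness identifies it with the given
  -- one.
  obtain ⟨rfl, rfl⟩ := hF₁.unique (hF t)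
  refine ⟨fun y => A y t, ⟨M, fun x => M x - A x t, hM, hM.smooth.sub (hA2.left t), ?_, ?_, ?_⟩,
    zero_curv⟩
  · intro x
    refine ⟨(hM.isOrthAlg hj x).sub (isOrthAlg_inv_mul_mderiv (hg.right x) (ho x) t), ?_⟩
    intro i k hik
    refine strictly_upper_of_upper_covD (D := fun x => M x - A x t)
      (hF t).curv_mem (fun x i => ?_) (fun x i k hki => ?_) x hik
    -- The first columns of $A$ and $M$ agree: differentiate $\gamma=ge_1$ in $t$ and compare with
    -- the flow.
    · have h1 : (g x t).mulVec ((A x t).mulVec (e1 n)) = (g x t).mulVec ((M x).mulVec (e1 n)) := by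
        rw [Matrix.mulVec_mulVec, Matrix.mulVec_mulVec, ← hgt, ← hflow x]
        have h2 : (fun s => γ x s) = fun s => (g x s).mulVec (e1 n) := by
          funext s
          rw [e1_eq_basisVec, (hF s).mulVec_eq_iteratedDeriv x (Nat.zero_le n),
            iteratedDeriv_zero]
        rw [h2, ((hg.right x).hasDerivAt_mulVec (hasDerivAt_const t _)).deriv,
          Matrix.mulVec_zero, add_zero]
      have h2 := Matrix.mulVec_injective_of_isUnit (ho x t).isUnit h1
      rw [e1_eq_basisVec] at h2
      have h3 := congrFun (mulVec_basisVec (A x t) 0) i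
      have h4 := congrFun (mulVec_basisVec (M x) 0) i
      rw [Matrix.sub_apply, sub_eq_zero]
      exact h4.symm.trans ((congrFun h2 i).symm.trans h3)
    · rw [covD_sub hM.smooth (hA2.left t), Matrix.sub_apply, hM.upper_covD hj x hki,
        ← zero_curv x, zero_sub, neg_eq_zero]
      exact upper_of_mem_V (mderiv_mem_V (hu.right x) (fun s => (hF s).curv_mem x) t) hki.le
  · intro x
    rw [sub_sub_cancel]
  · intro x
    rw [← zero_curv x]
    exact mderiv_mem_V (hu.right x) (fun s => (hF s).curv_mem x) t

/-! ### From the linear system to the curve flow -/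

section Gauge

variable {g u : ℝ → Mat n}

theorem Smooth1.contDiff_mulVec {M : ℝ → Mat n} (hM : Smooth1 M) {v : ℝ → Vec n}
    (hv : ContDiff ℝ ∞ v) : ContDiff ℝ ∞ fun x => (M x).mulVec (v x) :=
  contDiff_pi.2 fun i => by
    simp only [Matrix.mulVec, dotProduct]
    exact ContDiff.sum fun l _ => (hM i l).mul (contDiff_pi.1 hv l)

/-- The derivatives of `g e_1`, where `g_x = g (b + u)`, are given by a unipotent upper
triangular matrix in the basis formed by the columns of `g`. -/
theorem iteratedDeriv_mulVec_basisVec_zero (hg : Smooth1 g) (hu : Smooth1 u)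
    (hV : ∀ x, u x ∈ V n) (hx : ∀ x, mderiv g x = g x * (b n + u x)) (k : ℕ)
    (hk : k < 2 * n + 1) :
    ∃ v : ℝ → Vec n, ContDiff ℝ ∞ v ∧
      (∀ x, iteratedDeriv k (fun y => (g y).mulVec (basisVec n 0)) x = (g x).mulVec (v x)) ∧
      (∀ x i, k < i.val → v x i = 0) ∧ (∀ x i, i.val = k → v x i = 1) ∧
      (k ≤ n → ∀ x, v x = basisVec n k) := by
  induction k with
  | zero =>
    refine ⟨fun _ => basisVec n 0, contDiff_const, fun x => by rw [iteratedDeriv_zero],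
      fun x i hi => ?_, fun x i hi => ?_, fun _ _ => rfl⟩
    · exact if_neg (by omega)
    · exact if_pos hi
  | succ k ih =>
    obtain ⟨v, hv, h1, h2, h3, h4⟩ := ih (by omega)
    have hbu : Smooth1 fun x => b n + u x := (smooth1_const _).add hu
    have hdv : ∀ x, HasDerivAt v (deriv v x) x := fun x =>
      (hv.differentiable (by simp) x).hasDerivAt
    have hdv' : ∀ x i, HasDerivAt (fun y => v y i) (deriv v x i) x := fun x i =>
      hasDerivAt_pi.1 (hdv x) i
    have hsplit : ∀ x i, (deriv v x + (b n + u x).mulVec (v x)) i =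
        deriv v x i + ((b n).mulVec (v x) i + (u x).mulVec (v x) i) := fun x i => by
      rw [Matrix.add_mulVec]
      rfl
    have hu0 : ∀ x i, k < i.val → (u x).mulVec (v x) i = 0 := fun x i hi => by
      rw [Matrix.mulVec, dotProduct]
      refine Finset.sum_eq_zero fun l _ => ?_
      rcases Nat.lt_or_ge k l.val with hl | hl
      · rw [h2 x l hl, mul_zero]
      · rw [upper_of_mem_V (hV x) (by rw [Fin.le_def]; omega), zero_mul]
    have hd0 : ∀ x i, k < i.val → deriv v x i = 0 := fun x i hi => by
      have := (hdv' x i).deriv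
      rw [← this, show (fun y => v y i) = fun _ => 0 from funext fun y => h2 y i hi]
      exact deriv_const x 0
    -- From $(gv)_x=g(v_x+(b+u)v)$. Only $b$ reaches the new lowest position, and it moves the
    -- leading $1$ down by one.
    refine ⟨fun x => deriv v x + (b n + u x).mulVec (v x),
      ((contDiff_infty_iff_deriv).1 hv).2.add (hbu.contDiff_mulVec hv), ?_, ?_, ?_, ?_⟩
    · intro x
      rw [iteratedDeriv_succ, show iteratedDeriv k (fun y => (g y).mulVec (basisVec n 0)) =
        fun x => (g x).mulVec (v x) from funext h1, (hg.hasDerivAt_mulVec (hdv x)).deriv, hx,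
        Matrix.mulVec_add, Matrix.mulVec_mulVec, add_comm ((g x).mulVec _)]
    · intro x i hi
      obtain ⟨r, hr⟩ : ∃ r : Fin (2 * n + 1), i.val = r.val + 1 :=
        ⟨⟨i.val - 1, by have := i.isLt; omega⟩, by simp only; omega⟩
      refine (hsplit x i).trans ?_
      rw [hd0 x i (by omega), hu0 x i (by omega), b_mulVec_apply _ _ hr,
        h2 x r (by omega)]
      simp
    · intro x i hi
      obtain ⟨r, hr⟩ : ∃ r : Fin (2 * n + 1), i.val = r.val + 1 :=
        ⟨⟨i.val - 1, by have := i.isLt; omega⟩, by simp only; omega⟩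
      refine (hsplit x i).trans ?_
      rw [hd0 x i (by omega), hu0 x i (by omega), b_mulVec_apply _ _ hr,
        h3 x r (by omega)]
      simp
    · intro hkn x
      have hc : v = fun _ => basisVec n k := funext (h4 (by omega))
      simp only [hc, deriv_const, Matrix.add_mulVec]
      rw [b_mulVec_basisVec (by omega), mulVec_basisVec_of_mem_V (hV x) (by omega), add_zero,
        zero_add]

theorem iteratedDeriv_eq_column (hg : Smooth1 g) (hu : Smooth1 u)
    (hV : ∀ x, u x ∈ V n) (hx : ∀ x, mderiv g x = g x * (b n + u x)) {k : ℕ} (hk : k ≤ n)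
    (x : ℝ) :
    iteratedDeriv k (fun y => (g y).mulVec (basisVec n 0)) x = (g x).mulVec (basisVec n k) := by
  obtain ⟨v, -, h1, -, -, h4⟩ :=
    iteratedDeriv_mulVec_basisVec_zero hg hu hV hx k (by omega)
  rw [h1, h4 hk]

theorem linearIndependent_iteratedDeriv (hg : Smooth1 g) (hu : Smooth1 u)
    (ho : ∀ x, IsOrth n (g x)) (hV : ∀ x, u x ∈ V n)
    (hx : ∀ x, mderiv g x = g x * (b n + u x)) (x : ℝ) :
    LinearIndependent ℝ fun k : Fin (2 * n + 1) =>
      iteratedDeriv k.val (fun y => (g y).mulVec (basisVec n 0)) x := by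
  choose v _ h1 h2 h3 _ using fun k : Fin (2 * n + 1) =>
    iteratedDeriv_mulVec_basisVec_zero hg hu hV hx k.val k.isLt
  let T : Mat n := Matrix.of fun i k => v k x i
  have hT : T.det = 1 := by
    rw [Matrix.det_of_isUpperTriangular (M := T) (fun i k hki => h2 k x i hki)]
    exact Finset.prod_eq_one fun i _ => h3 i x i rfl
  have hgd : (g x).det ≠ 0 := ((Matrix.isUnit_iff_isUnit_det _).1 (ho x).isUnit).ne_zero
  have h := Matrix.linearIndependent_cols_of_det_ne_zero (A := g x * T)
    (by rw [Matrix.det_mul, hT, mul_one]; exact hgd)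
  have heq : (fun k : Fin (2 * n + 1) =>
      iteratedDeriv k.val (fun y => (g y).mulVec (basisVec n 0)) x) = (g x * T).col :=
    funext fun k => h1 k x
  rw [heq]
  exact h

end Gauge

/-- The first `n` columns of an element of `O(n+1,n)` span a maximal isotropic subspace. -/
theorem maximal_isotropic_columns {g : Mat n} (hg : IsOrth n g) :
    Maximal (IsIsotropicSubspace n)
      (Submodule.span ℝ (Set.range fun k : Fin n => g.mulVec (basisVec n k.val))) := by
  constructor
  · intro X hX Y hY
    induction hX, hY using Submodule.span_induction₂ with
    | mem_mem X Y hX hY =>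
      obtain ⟨k, rfl⟩ := hX
      obtain ⟨l, rfl⟩ := hY
      simp only
      rw [form_mulVec hg, form_basisVec (by omega), if_neg (by omega)]
    | zero_left Y _ => exact form_zero_left Y
    | zero_right X _ => exact form_zero_right X
    | add_left X Y Z _ _ _ h1 h2 => rw [form_add_left, h1, h2, add_zero]
    | add_right X Y Z _ _ _ h1 h2 => rw [form_add_right, h1, h2, add_zero]
    | smul_left a X Y _ _ h => rw [form_smul_left, h, mul_zero]
    | smul_right a X Y _ _ h => rw [form_smul_right, h, mul_zero]
  · intro W hW hle X hX
    have hcol : ∀ k, k < n → g.mulVec (basisVec n k) ∈ W := fun k hk =>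
      hle (Submodule.subset_span ⟨⟨k, hk⟩, rfl⟩)
    have hgg : g * g⁻¹ = 1 :=
      Matrix.mul_nonsing_inv g ((Matrix.isUnit_iff_isUnit_det g).1 hg.isUnit)
    -- In the coordinates `Y` along the columns of $g$, orthogonality to the first $n$ columns kills
    -- the last $n$ coordinates; then $\langle X,X\rangle=0$ reduces to the square of the middle
    -- one.
    set Y := g⁻¹.mulVec X with hY
    have hXY : X = g.mulVec Y := by rw [hY, Matrix.mulVec_mulVec, hgg, Matrix.one_mulVec]
    have h1 : ∀ i : Fin (2 * n + 1), n < i.val → Y i = 0 := by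
      intro i hi
      have h := hW _ (hcol i.rev.val (by rw [Fin.val_rev]; omega)) X hX
      rw [hXY, form_mulVec hg, form_basisVec_left, Fin.rev_rev, mul_eq_zero] at h
      exact h.resolve_left (pow_ne_zero _ (by norm_num))
    have h2 : ∀ i : Fin (2 * n + 1), i.val = n → Y i = 0 := by
      intro i hi
      have h := hW X hX X hX
      have hir : i.rev = i := Fin.ext (by rw [Fin.val_rev]; omega)
      rw [hXY, form_mulVec hg, form_apply, Finset.sum_eq_single i] at h
      · rw [hir] at h
        have hs : (-1 : ℝ) ^ (n + i.val) ≠ 0 := pow_ne_zero _ (by norm_num)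
        rcases mul_eq_zero.1 h with h | h
        · exact h
        · exact (mul_eq_zero.1 h).resolve_left hs
      · intro l _ hl
        have hl' : l.val ≠ n := fun h => hl (Fin.ext (h.trans hi.symm))
        rcases Nat.lt_or_ge n l.val with hln | hln
        · rw [h1 l hln, zero_mul]
        · rw [h1 l.rev (by rw [Fin.val_rev]; omega), mul_zero, mul_zero]
      · simp
    have hsum : X = ∑ k : Fin (2 * n + 1), Y k • g.mulVec (basisVec n k.val) := by
      rw [hXY]
      ext i
      rw [Finset.sum_apply, Matrix.mulVec, dotProduct]
      refine Finset.sum_congr rfl fun k _ => ?_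
      rw [Pi.smul_apply, mulVec_basisVec, smul_eq_mul, mul_comm]
    rw [hsum]
    refine Submodule.sum_mem _ fun k _ => ?_
    rcases Nat.lt_trichotomy k.val n with h | h | h
    · exact Submodule.smul_mem _ _ (Submodule.subset_span ⟨⟨k.val, h⟩, rfl⟩)
    · rw [h2 k h, zero_smul]
      exact Submodule.zero_mem _
    · rw [h1 k h, zero_smul]
      exact Submodule.zero_mem _

section Gauge

variable {g u : ℝ → Mat n}

theorem mem_curveSpace_of_gauge (hg : Smooth1 g) (hu : Smooth1 u)
    (ho : ∀ x, IsOrth n (g x)) (hV : ∀ x, u x ∈ V n)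
    (hx : ∀ x, mderiv g x = g x * (b n + u x)) :
    (fun x => (g x).mulVec (e1 n)) ∈ curveSpace n := by
  rw [e1_eq_basisVec]
  refine ⟨⟨hg.contDiff_mulVec contDiff_const,
    linearIndependent_iteratedDeriv hg hu ho hV hx, fun x => ?_⟩, fun x => ?_⟩
  · simp_rw [fun k : Fin n => iteratedDeriv_eq_column hg hu hV hx k.isLt.le x]
    exact maximal_isotropic_columns (ho x)
  · rw [iteratedDeriv_eq_column hg hu hV hx le_rfl, form_mulVec (ho x),
      form_basisVec (by omega), if_pos (by omega), Even.neg_one_pow ⟨n, rfl⟩]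

theorem isFrame_of_gauge (hg : Smooth1 g) (hu : Smooth1 u)
    (ho : ∀ x, IsOrth n (g x)) (hV : ∀ x, u x ∈ V n)
    (hx : ∀ x, (g x)⁻¹ * mderiv g x = b n + u x) :
    IsFrame n (fun x => (g x).mulVec (e1 n)) g u where
  smooth := hg
  orth := ho
  col x k hk := by
    rw [e1_eq_basisVec, iteratedDeriv_eq_column hg hu hV
      (fun x => mderiv_eq_of_inv_mul (ho x).isUnit (hx x)) hk, mulVec_basisVec]
  smooth_curv := hu
  curv_mem := hV
  eqn := hx

end Gauge

theorem IsFlowMatrix.isOrthAlg {ty : AffineType} {j : ℕ} {u Q : ℝ → Mat n} (hj : 1 ≤ j)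
    (h : IsFlowMatrix n ty j u Q) (x : ℝ) : IsOrthAlg n (Q x) := by
  obtain ⟨M, η, hM, -, hη, hQ, -⟩ := h
  rw [hQ]
  exact (hM.isOrthAlg hj x).sub (hη x).1

/-- A solution of the linear system with initial value in `O(n+1,n)` stays in `O(n+1,n)`. -/
theorem IsLinearSystemSolution.isOrth {ty : AffineType} {j : ℕ} (hj : 1 ≤ j)
    {u g : ℝ → ℝ → Mat n} (hV : ∀ x t, u x t ∈ V n) (h : IsLinearSystemSolution n ty j u g)
    (h0 : IsOrth n (g 0 0)) (x t : ℝ) : IsOrth n (g x t) := by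
  have hs : ∀ {M : ℝ → Mat n}, Smooth1 M → Smooth1 fun y => M y * Cform n * (M y).transpose :=
    fun hM => (hM.mul (smooth1_const _)).mul hM.transpose
  -- Move to $x=0$ at fixed $t$ by the $x$-equation, then along $x=0$ to the origin by the
  -- $t$-equation.
  have hX : ∀ x t, g x t * Cform n * (g x t).transpose = g 0 t * Cform n * (g 0 t).transpose :=
    fun x t => eq_of_mderiv_eq_zero (hs (h.smooth.left t)) (fun y =>
      mderiv_conj (h.smooth.left t) (mderiv_eq_of_inv_mul (h.unit y t) (h.eqn_x y t))
        (isOrthAlg_b.add (isOrthAlg_of_mem_V (hV y t)))) x 0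
  have hT : g 0 t * Cform n * (g 0 t).transpose = g 0 0 * Cform n * (g 0 0).transpose :=
    eq_of_mderiv_eq_zero (hs (h.smooth.right 0)) (fun s => by
      obtain ⟨Q, hQ, hgQ⟩ := h.eqn_t s
      exact mderiv_conj (h.smooth.right 0) (mderiv_eq_of_inv_mul (h.unit 0 s) (hgQ 0))
        (hQ.isOrthAlg hj 0)) t 0
  exact isOrth_of_transpose ((hX x t).trans (hT.trans h0.mul_transpose))

theorem isCurveFlowSolution_of_isLinearSystemSolution {ty : AffineType} {j : ℕ} (hj : 1 ≤ j)
    {u g : ℝ → ℝ → Mat n} (hu : Smooth2 u) (hV : ∀ x t, u x t ∈ V n)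
    (h : IsLinearSystemSolution n ty j u g) (h0 : IsOrth n (g 0 0)) :
    IsCurveFlowSolution n ty j (fun x t => (g x t).mulVec (e1 n)) ∧
      ∀ t, IsFrame n (fun x => (g x t).mulVec (e1 n)) (fun x => g x t) (fun x => u x t) := by
  have ho := h.isOrth hj hV h0
  have hF : ∀ t, IsFrame n (fun x => (g x t).mulVec (e1 n)) (fun x => g x t)
      (fun x => u x t) := fun t =>
    isFrame_of_gauge (h.smooth.left t) (hu.left t) (fun x => ho x t) (fun x => hV x t)
      (fun x => h.eqn_x x t)
  refine ⟨⟨?_, fun t => ?_, fun t => ?_⟩, hF⟩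
  · refine contDiff_pi.2 fun i => ?_
    simp only [Matrix.mulVec, dotProduct]
    exact ContDiff.sum fun l _ => (h.smooth i l).mul contDiff_const
  · exact mem_curveSpace_of_gauge (h.smooth.left t) (hu.left t) (fun x => ho x t)
      (fun x => hV x t) (fun x => (hF t).mderiv_eq x)
  · obtain ⟨Q, ⟨M, η, hM, -, hη, hQ, -⟩, hgQ⟩ := h.eqn_t t
    refine ⟨_, _, M, hF t, hM, fun x => ?_⟩
    -- The first column of a strictly upper triangular matrix is zero, so $\eta$ is invisible to
    -- $\gamma=ge_1$.
    have hη0 : (η x).mulVec (e1 n) = 0 := by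
      rw [e1_eq_basisVec]
      refine (mulVec_basisVec (η x) 0).trans ?_
      ext i
      exact (hη x).2 i 0 (Fin.zero_le i)
    rw [((h.smooth.right x).hasDerivAt_mulVec (hasDerivAt_const t _)).deriv, Matrix.mulVec_zero,
      add_zero, mderiv_eq_of_inv_mul (h.unit x t) (hgQ x), hQ, ← Matrix.mulVec_mulVec,
      Matrix.sub_mulVec, hη0, sub_zero, Matrix.mulVec_mulVec]

end IsotropicFlow

end

theorem mainTheorem1 (n : ℕ) (hn : 1 ≤ n) (ty : IsotropicFlow.AffineType)
    (j : ℕ) (hj : 1 ≤ j)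
    (hA : ty = IsotropicFlow.AffineType.A → ¬ (2 * n + 1 ∣ 2 * j - 1)) :
    (∀ γ : ℝ → ℝ → IsotropicFlow.Vec n,
      IsotropicFlow.IsCurveFlowSolution n ty j γ →
      ∀ g u : ℝ → ℝ → IsotropicFlow.Mat n,
        (∀ t, IsotropicFlow.IsFrame n (fun x => γ x t) (fun x => g x t) (fun x => u x t)) →
        IsotropicFlow.IsKdVSolution n ty j u) ∧
    (∀ u : ℝ → ℝ → IsotropicFlow.Mat n,
      IsotropicFlow.IsKdVSolution n ty j u →
      ∀ c₀ : IsotropicFlow.Mat n, IsotropicFlow.IsOrth n c₀ →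
      ∀ g : ℝ → ℝ → IsotropicFlow.Mat n,
        IsotropicFlow.IsLinearSystemSolution n ty j u g → g 0 0 = c₀ →
        IsotropicFlow.IsCurveFlowSolution n ty j
          (fun x t => (g x t).mulVec (IsotropicFlow.e1 n)) ∧
        ∀ t, IsotropicFlow.IsFrame n (fun x => (g x t).mulVec (IsotropicFlow.e1 n))
          (fun x => g x t) (fun x => u x t)) :=
  ⟨fun _ hγ _ _ hF => IsotropicFlow.isKdVSolution_of_isCurveFlowSolution hj hγ hF,
    fun _ hu _ hc _ hg h0 =>
      IsotropicFlow.isCurveFlowSolution_of_isLinearSystemSolution hj hu.smooth hu.mem hg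
        (h0 ▸ hc)⟩
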